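/- For a small category $\mathcal C$, let $\mathcal C\text{-mod}$ be the abelian category of functors $\mathcal C\to\mathbf{Ab}$ (left $\mathcal C$-modules) and $\mathcal C^{op}\text{-mod}$ that of functors $\mathcal C^{op}\to\mathbf{Ab}$ (right $\mathcal C$-modules). For an object $x$ let $P_x=\mathbb Z[\operatorname{Hom}_{\mathcal C}(x,-)]$. For $F\in\mathcal C\text{-mod}$ let $DF$ be the right module $x\mapsto\operatorname{Hom}_{\mathcal C\text{-mod}}(F,P_x)$, let $RD$ be the derived functor of the contravariant functor $D$, and put $D^i(F)=H^i(RD(F))$, so that $D^i(F)(x)=\operatorname{Ext}^i_{\mathcal C\text{-mod}}(F,P_x)$. The module $F$ is of type $FP$ if it has a finite resolution by projectives each of which is a quotient of a finite direct sum of modules $P_x$. It is a duality functor of degree $n$ if it is of type $FP$ and $RD(F)\cong D^n(F)[n]$ in the derived category of $\mathcal C^{op}\text{-mod}$, where $D^n(F)[n]$ is $D^n(F)$ placed in cohomological degree $n$. The category $\mathcal C$ is a duality category if the constant functor $\underline{\mathbb Z}$ is a duality functor of some degree. Let $\operatorname{Tor}^{\mathcal C}_*$ be the left derived functors of $F\otimes_{\mathcal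 C}G=\bigl(\bigoplus_x F(x)\otimes G(x)\bigr)/\bigl(F(f)a\otimes b-a\otimes G(f)b\bigr)$. The groups $\operatorname{Ext}^i$, $\operatorname{Tor}_i$ and $D^i$ are $0$ for $i<0$. **Theorem.** Let $\Delta$ be a simplicial complex with finitely many simplices and let $\mathcal P$ be the poset of its (non-empty) simplices ordered by inclusion, regarded as a category. For $x\in\mathcal P$ let $\dim(x)=|x|-1$ and let $\operatorname{link}_x$ be the simplicial complex of the non-empty $y$ with $x\cap y=\emptyset$ and $x\cup y\in\Delta$. Suppose there is an integer $n$ such that for every $x\in\mathcal P$ $$\widetilde H^{i}(\operatorname{link}_x;\mathbb Z)=0\quad\text{for all integers } i\neq n-\dim(x)-1,$$ where $\widetilde H^*$ is reduced cohomology (so $\widetilde H^{-1}(\emptyset;\mathbb Z)=\mathbb Z$). Then $\mathcal P$ is a duality category; more precisely, $\underline{\mathbb Z}$ is a duality functor of degree $n$, and for every integer $i$ there is an isomorphism of functors on $\mathcal P\text{-mod}$ $$\operatorname{Ext}^i_{\mathcal P\text{-mod}}(\underline{\mathbb Z},-)\cong\operatorname{Tor}^{\mathcal P}_{n-i}(D^n(\underline{\mathbb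 Z}),-).$$ -/

import Mathlib

open CategoryTheory CategoryTheory.Limits Opposite
open scoped TensorProduct DirectSum

universe u

noncomputable section

namespace DualityCategory

/-! ### Modules over a small category -/

/-- Left `C`-modules: covariant functors from `C` to `k`-modules.
Right `C`-modules are the objects of `CMod k Cᵒᵖ`. For `k = ℤ` these are functors to abelian
groups. -/
abbrev CMod (k : Type) [CommRing k] (C : Type u) [SmallCategory C] : Type (u + 1) :=
  C ⥤ ModuleCat.{u} k

/-- The free module functor `S ↦ k[S]`. -/
def freeMod (k : Type) [CommRing k] : Type u ⥤ ModuleCat.{u} k where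
  obj S := ModuleCat.of k (S →₀ k)
  map f := ModuleCat.ofHom (Finsupp.lmapDomain k k (f : _ → _))
  map_id S := by
    ext : 1
    exact Finsupp.lmapDomain_id k k
  map_comp f g := by
    ext : 1
    exact Finsupp.lmapDomain_comp k k (f : _ → _) (g : _ → _)

/-- The bifunctor `(x, y) ↦ k[Hom(x, y)]`: it sends `x` to the standard projective
`P_x = k[Hom(x, -)]`. -/
def standardProjective (k : Type) [CommRing k] (C : Type u) [SmallCategory C] :
    Cᵒᵖ ⥤ CMod k C :=
  coyoneda ⋙ (Functor.whiskeringRight C _ _).obj (freeMod k)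

/-- The constant functor with value `k`. -/
def constMod (k : Type) [CommRing k] (C : Type u) [SmallCategory C] : CMod k C :=
  (Functor.const C).obj (ModuleCat.of k (ULift.{u} k))

section EnoughProjectives

variable {k : Type} [CommRing k] {C : Type u} [SmallCategory C]

/-- The morphism `P_x ⟶ F` that sends the identity of `x` to `a`. -/
def ofElement {F : CMod k C} {x : C} (a : F.obj x) :
    (standardProjective k C).obj (op x) ⟶ F where
  app y := ModuleCat.ofHom
    (Finsupp.linearCombination k (fun f : x ⟶ y => (F.map f).hom a))
  naturality y z g := by
    ext : 1
    refine Finsupp.lhom_ext' fun f => LinearMap.ext_ring ?_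
    change Finsupp.linearCombination k (fun f : x ⟶ z => (F.map f).hom a)
        (Finsupp.mapDomain (fun h : x ⟶ y => h ≫ g) (Finsupp.single f 1)) =
      (F.map g).hom (Finsupp.linearCombination k (fun f : x ⟶ y => (F.map f).hom a)
        (Finsupp.single f 1))
    simp [Finsupp.mapDomain_single]

lemma ofElement_apply_id {F : CMod k C} {x : C} (a : F.obj x) :
    ((ofElement a).app x).hom (Finsupp.single (𝟙 x) (1 : k)) = a := by
  change Finsupp.linearCombination k (fun f : x ⟶ x => (F.map f).hom a)
    (Finsupp.single (𝟙 x) 1) = a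
  simp

lemma standardProjective_hom_ext {F : CMod k C} {x : C}
    {φ ψ : (standardProjective k C).obj (op x) ⟶ F}
    (h : (φ.app x).hom (Finsupp.single (𝟙 x) (1 : k)) =
      (ψ.app x).hom (Finsupp.single (𝟙 x) (1 : k))) : φ = ψ := by
  have key : ∀ (χ : (standardProjective k C).obj (op x) ⟶ F) (y : C) (f : x ⟶ y),
      (χ.app y).hom (Finsupp.single f (1 : k)) =
        (F.map f).hom ((χ.app x).hom (Finsupp.single (𝟙 x) (1 : k))) := by
    intro χ y f
    have h1 := congrArg (fun t => t.hom (Finsupp.single (𝟙 x) (1 : k))) (χ.naturality f)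
    refine Eq.trans ?_ h1
    change _ = (χ.app y).hom
      (Finsupp.mapDomain (fun g : x ⟶ x => g ≫ f) (Finsupp.single (𝟙 x) (1 : k)))
    rw [Finsupp.mapDomain_single, Category.id_comp]
  ext y : 3
  refine Finsupp.lhom_ext' fun f => LinearMap.ext_ring ?_
  change (φ.app y).hom (Finsupp.single f (1 : k)) = (ψ.app y).hom (Finsupp.single f (1 : k))
  exact (key φ y f).trans ((congrArg (F.map f).hom h).trans (key ψ y f).symm)

instance projective_standardProjective (x : Cᵒᵖ) :
    Projective ((standardProjective k C).obj x) where
  factors {E X} f e _ := by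
    have he : Function.Surjective (e.app x.unop).hom :=
      (ModuleCat.epi_iff_surjective _).1 inferInstance
    obtain ⟨b, hb⟩ := he ((f.app x.unop).hom (Finsupp.single (𝟙 x.unop) (1 : k)))
    refine ⟨ofElement b, standardProjective_hom_ext ?_⟩
    rw [← hb]
    exact congrArg (e.app x.unop).hom (ofElement_apply_id b)

/-- The category of modules over a small category has enough projectives. -/
instance enoughProjectives_cMod : EnoughProjectives (CMod k C) where
  presentation F := ⟨{
    p := ∐ fun s : Σ x : C, F.obj x => (standardProjective k C).obj (op s.1)
    f := Sigma.desc fun s => ofElement s.2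
    epi := by
      rw [NatTrans.epi_iff_epi_app]
      intro x
      rw [ModuleCat.epi_iff_surjective]
      intro a
      have h := Sigma.ι_desc (fun s : Σ x : C, F.obj x => ofElement s.2) ⟨x, a⟩
      have h2 := congrArg (fun t => (t.app x).hom (Finsupp.single (𝟙 x) (1 : k))) h
      exact ⟨_, h2.trans (ofElement_apply_id a)⟩ }⟩

end EnoughProjectives

/-! ### Tensor product and torsion groups over a small category -/

section Tensor

variable {k : Type} [CommRing k] {C : Type u} [SmallCategory C]

/-- The direct sum of the modules `F(x) ⊗ G(x)` over the objects `x`. -/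
abbrev TensorSum (F : CMod k Cᵒᵖ) (G : CMod k C) : Type u :=
  ⨁ x : C, (F.obj (op x) ⊗[k] G.obj x)

open Classical in
/-- The submodule generated by `F(f)(a) ⊗ b - a ⊗ G(f)(b)` for `f : x ⟶ y`, `a ∈ F(y)`,
`b ∈ G(x)`. -/
def tensorRel (F : CMod k Cᵒᵖ) (G : CMod k C) : Submodule k (TensorSum F G) :=
  Submodule.span k {t | ∃ (x y : C) (f : x ⟶ y) (a : F.obj (op y)) (b : G.obj x),
    t = DirectSum.lof k C (fun z => F.obj (op z) ⊗[k] G.obj z) x ((F.map f.op).hom a ⊗ₜ b) -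
      DirectSum.lof k C (fun z => F.obj (op z) ⊗[k] G.obj z) y (a ⊗ₜ (G.map f).hom b)}

/-- The map on direct sums induced by morphisms of modules. -/
def tensorSumMap {F F' : CMod k Cᵒᵖ} {G G' : CMod k C} (φ : F ⟶ F') (ψ : G ⟶ G') :
    TensorSum F G →ₗ[k] TensorSum F' G' :=
  DirectSum.lmap fun x => TensorProduct.map (φ.app (op x)).hom (ψ.app x).hom

lemma tensorRel_le {F F' : CMod k Cᵒᵖ} {G G' : CMod k C} (φ : F ⟶ F') (ψ : G ⟶ G') :
    tensorRel F G ≤ (tensorRel F' G').comap (tensorSumMap φ ψ) := by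
  classical
  refine Submodule.span_le.2 ?_
  rintro _ ⟨x, y, f, a, b, rfl⟩
  refine Submodule.subset_span ⟨x, y, f, (φ.app (op y)).hom a, (ψ.app x).hom b, ?_⟩
  have h1 : (φ.app (op x)).hom ((F.map f.op).hom a) =
      (F'.map f.op).hom ((φ.app (op y)).hom a) :=
    congrArg (fun t => t.hom a) (φ.naturality f.op)
  have h2 : (ψ.app y).hom ((G.map f).hom b) = (G'.map f).hom ((ψ.app x).hom b) :=
    congrArg (fun t => t.hom b) (ψ.naturality f)
  rw [map_sub]
  simp only [tensorSumMap, DirectSum.lmap_lof, TensorProduct.map_tmul, h1, h2]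

lemma tensorSumMap_id (F : CMod k Cᵒᵖ) (G : CMod k C) :
    tensorSumMap (𝟙 F) (𝟙 G) = LinearMap.id := by
  classical
  refine DirectSum.linearMap_ext _ fun x => TensorProduct.ext' fun a b => ?_
  simp [tensorSumMap]

lemma tensorSumMap_comp {F F' F'' : CMod k Cᵒᵖ} {G G' G'' : CMod k C} (φ : F ⟶ F')
    (φ' : F' ⟶ F'') (ψ : G ⟶ G') (ψ' : G' ⟶ G'') :
    tensorSumMap (φ ≫ φ') (ψ ≫ ψ') = tensorSumMap φ' ψ' ∘ₗ tensorSumMap φ ψ := by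
  classical
  refine DirectSum.linearMap_ext _ fun x => TensorProduct.ext' fun a b => ?_
  simp [tensorSumMap]

/-- The map `F ⊗_C G ⟶ F' ⊗_C G'` induced by morphisms of modules. -/
def tensorMap {F F' : CMod k Cᵒᵖ} {G G' : CMod k C} (φ : F ⟶ F') (ψ : G ⟶ G') :
    ModuleCat.of k (TensorSum F G ⧸ tensorRel F G) ⟶
      ModuleCat.of k (TensorSum F' G' ⧸ tensorRel F' G') :=
  ModuleCat.ofHom (Submodule.mapQ _ _ (tensorSumMap φ ψ) (tensorRel_le φ ψ))

lemma tensorMap_id (F : CMod k Cᵒᵖ) (G : CMod k C) : tensorMap (𝟙 F) (𝟙 G) = 𝟙 _ := by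
  ext : 1
  refine Submodule.linearMap_qext _ (LinearMap.ext fun t => ?_)
  simp [tensorMap, tensorSumMap_id]

lemma tensorMap_comp {F F' F'' : CMod k Cᵒᵖ} {G G' G'' : CMod k C} (φ : F ⟶ F')
    (φ' : F' ⟶ F'') (ψ : G ⟶ G') (ψ' : G' ⟶ G'') :
    tensorMap φ ψ ≫ tensorMap φ' ψ' = tensorMap (φ ≫ φ') (ψ ≫ ψ') := by
  ext : 1
  refine Submodule.linearMap_qext _ (LinearMap.ext fun t => ?_)
  simp [tensorMap, tensorSumMap_comp]

/-- The tensor product over `C` as a bifunctor `(F, G) ↦ F ⊗_C G`. -/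
def tensor (k : Type) [CommRing k] (C : Type u) [SmallCategory C] :
    CMod k Cᵒᵖ ⥤ CMod k C ⥤ ModuleCat.{u} k where
  obj F :=
    { obj := fun G => ModuleCat.of k (TensorSum F G ⧸ tensorRel F G)
      map := fun ψ => tensorMap (𝟙 F) ψ
      map_id := fun G => tensorMap_id F G
      map_comp := fun ψ ψ' => by rw [tensorMap_comp, Category.comp_id] }
  map φ :=
    { app := fun G => tensorMap φ (𝟙 G)
      naturality := fun G G' ψ => by
        rw [tensorMap_comp, tensorMap_comp]
        simp only [Category.comp_id, Category.id_comp] }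
  map_id F := by
    ext G : 2
    exact tensorMap_id F G
  map_comp φ φ' := by
    ext G : 2
    exact (by rw [tensorMap_comp, Category.comp_id] :
      tensorMap (φ ≫ φ') (𝟙 G) = tensorMap φ (𝟙 G) ≫ tensorMap φ' (𝟙 G))

instance tensor_flip_additive (G : CMod k C) : ((tensor k C).flip.obj G).Additive where
  map_add {F F' φ φ'} := by
    have h : tensorSumMap (φ + φ') (𝟙 G) = tensorSumMap φ (𝟙 G) + tensorSumMap φ' (𝟙 G) := by
      classical
      refine DirectSum.linearMap_ext _ fun x => TensorProduct.ext' fun a b => ?_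
      simp [tensorSumMap, TensorProduct.add_tmul]
    change tensorMap (φ + φ') (𝟙 G) = tensorMap φ (𝟙 G) + tensorMap φ' (𝟙 G)
    ext : 1
    refine Submodule.linearMap_qext _ (LinearMap.ext fun t => ?_)
    simp [tensorMap, h]

/-- The torsion groups `Tor_j^C(F, G)`, `j ≥ 0`, as a functor of the left module `G`: the left
derived functors of the tensor product, computed by projective resolutions of the right module
`F`. -/
def torNat (F : CMod k Cᵒᵖ) (j : ℕ) : CMod k C ⥤ ModuleCat.{u} k where
  obj G := (((tensor k C).flip.obj G).leftDerived j).obj F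
  map g := (NatTrans.leftDerived ((tensor k C).flip.map g) j).app F
  map_id G := by simp
  map_comp f g := by simp

/-- `Tor_j^C(F, -)` for an integer `j`; it vanishes in negative degrees. -/
def tor (F : CMod k Cᵒᵖ) : ℤ → (CMod k C ⥤ ModuleCat.{u} k)
  | .ofNat j => torNat F j
  | .negSucc _ => (Functor.const _).obj (ModuleCat.of k PUnit)

/-- `Ext^i_C(F, -)` for an integer `i`; it vanishes in negative degrees. -/
def ext (F : CMod k C) : ℤ → (CMod k C ⥤ ModuleCat.{u} k)
  | .ofNat i => (Ext k (CMod k C) i).obj (op F)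
  | .negSucc _ => (Functor.const _).obj (ModuleCat.of k PUnit)

end Tensor

/-! ### The functor of duality and duality functors -/

section Duality

/-- The functor of duality `D`: it sends a left module `F` to the right module
`x ↦ Hom(F, P_x)`. -/
def dual (k : Type) [CommRing k] (C : Type u) [SmallCategory C] :
    (CMod k C)ᵒᵖ ⥤ CMod k Cᵒᵖ :=
  linearCoyoneda k (CMod k C) ⋙ (Functor.whiskeringLeft _ _ _).obj (standardProjective k C)

instance dual_rightOp_additive (k : Type) [CommRing k] (C : Type u) [SmallCategory C] :
    (dual k C).rightOp.Additive where
  map_add {F F' φ φ'} := by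
    apply Quiver.Hom.unop_inj
    ext x : 3
    refine LinearMap.ext fun (α : F' ⟶ (standardProjective k C).obj x) => ?_
    exact Preadditive.add_comp _ _ _ φ φ' α

variable {k : Type} [CommRing k] {C : Type u} [SmallCategory C]

/-- The cochain complex `D(P₀) ⟶ D(P₁) ⟶ ⋯` obtained from a chain complex `P`. -/
def dualComplex (P : ChainComplex (CMod k C) ℕ) : CochainComplex (CMod k Cᵒᵖ) ℕ :=
  (((dual k C).rightOp.mapHomologicalComplex _).obj P).unop

/-- `D^i(F) = H^i(RD(F))`, the `i`-th derived functor of the functor of duality; on objects it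
is `x ↦ Ext^i(F, P_x)`. It vanishes for `i < 0`. -/
def derivedDual (F : CMod k C) : ℤ → CMod k Cᵒᵖ
  | .ofNat i => (((dual k C).rightOp.leftDerived i).obj F).unop
  | .negSucc _ => (Functor.const _).obj (ModuleCat.of k PUnit)

/-- `RD(F) ≅ D^n(F)[n]` in the derived category of right modules, where `D^n(F)[n]` is `D^n(F)`
placed in cohomological degree `n`. Here `RD(F)` is obtained by applying `D` to a projective
resolution of `F`. -/
def IsEilenbergMacLane (F : CMod k C) (n : ℤ) : Prop :=
  letI : HasDerivedCategory (CMod k Cᵒᵖ) := HasDerivedCategory.standard _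
  Nonempty (DerivedCategory.Q.obj
      ((dualComplex (projectiveResolution F).complex).extend ComplexShape.embeddingUpNat) ≅
    (DerivedCategory.singleFunctor (CMod k Cᵒᵖ) n).obj (derivedDual F n))

/-- A module is of finite type if it is a quotient of a finite direct sum of standard
projectives. -/
def IsFiniteType (M : CMod k C) : Prop :=
  ∃ (m : ℕ) (x : Fin m → C)
    (p : (∐ fun j => (standardProjective k C).obj (op (x j))) ⟶ M), Epi p

/-- A module is of type `FP` if it has a finite resolution by projectives of finite type. -/
def IsTypeFP (F : CMod k C) : Prop :=
  ∃ P : ProjectiveResolution F, (∀ i, IsFiniteType (P.complex.X i)) ∧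
    ∃ N : ℕ, ∀ i, N < i → IsZero (P.complex.X i)

/-- `F` is a duality functor of degree `n`. -/
structure IsDualityFunctorOfDegree (F : CMod k C) (n : ℤ) : Prop where
  typeFP : IsTypeFP F
  eilenbergMacLane : IsEilenbergMacLane F n

/-- A duality functor is a module of type `FP` whose derived dual is concentrated in a single
degree. -/
def IsDualityFunctor (F : CMod k C) : Prop := ∃ n : ℤ, IsDualityFunctorOfDegree F n

/-- A small category is a duality category if the constant functor `ℤ` is a duality functor. -/
def IsDualityCategory (C : Type u) [SmallCategory C] : Prop := IsDualityFunctor (constMod ℤ C)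

end Duality

/-! ### Simplicial complexes: links and reduced cohomology -/

section Simplicial

variable {V : Type u}

/-- The dimension of a simplex. -/
def dim (s : Finset V) : ℤ := (s.card : ℤ) - 1

open Classical in
/-- The link of a simplex `x`: the subcomplex of the simplices `s` that are disjoint from `x`
and such that `s ∪ x` is a simplex. -/
def link (K : PreAbstractSimplicialComplex V) (x : Finset V) :
    PreAbstractSimplicialComplex V where
  faces := {s | s.Nonempty ∧ Disjoint s x ∧ s ∪ x ∈ K.faces}
  isRelLowerSet_faces := by
    rintro s ⟨hs, hd, hK⟩
    refine ⟨hs, fun t hts ht => ⟨ht, Finset.disjoint_of_subset_left hts hd, ?_⟩⟩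
    exact (K.isRelLowerSet_faces hK).2 (Finset.union_subset_union_left hts)
      (ht.mono Finset.subset_union_left)

/-- The simplices of dimension `i` of a complex, together with the empty simplex, which has
dimension `-1`. -/
def AugSimplex (K : PreAbstractSimplicialComplex V) (i : ℤ) : Type u :=
  {s : Finset V // (s = ∅ ∨ s ∈ K.faces) ∧ dim s = i}

/-- The face of a simplex opposite to the vertex `v`. -/
def AugSimplex.face [DecidableEq V] {K : PreAbstractSimplicialComplex V} {i : ℤ}
    (s : AugSimplex K (i + 1)) (v : s.1) : AugSimplex K i :=
  ⟨s.1.erase v, by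
    obtain ⟨s, hs, hd⟩ := s
    refine ⟨?_, ?_⟩
    · rcases Finset.eq_empty_or_nonempty (s.erase v) with h | h
      · exact Or.inl h
      · rcases hs with rfl | hs
        · exact absurd v.2 (Finset.notMem_empty _)
        · exact Or.inr ((K.isRelLowerSet_faces hs).2 (Finset.erase_subset _ _) h)
    · have := Finset.card_erase_add_one v.2
      simp only [dim] at hd ⊢
      change (((s.erase v).card : ℤ) - 1) = i
      have h2 : ((s.erase v).card : ℤ) + 1 = s.card := by exact_mod_cast this
      omega⟩

/-- The coboundary `(δc)(s) = ∑ (-1)^j c(s ∖ {v_j})` for `s = {v_0 < v_1 < ⋯}`. -/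
def coboundary [LinearOrder V] (K : PreAbstractSimplicialComplex V) (i : ℤ) :
    (AugSimplex K i → ℤ) →ₗ[ℤ] (AugSimplex K (i + 1) → ℤ) where
  toFun c s := ∑ v : s.1, (-1) ^ (s.1.filter (· < (v : V))).card * c (s.face v)
  map_add' c c' := by
    funext s
    simp [mul_add, Finset.sum_add_distrib]
  map_smul' r c := by
    funext s
    simp only [Pi.smul_apply, smul_eq_mul, RingHom.id_apply, Finset.mul_sum]
    exact Finset.sum_congr rfl fun v _ => by ring

lemma card_filter_erase [LinearOrder V] (s : Finset V) {v w : V} (h : w < v) :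
    ((s.erase v).filter (· < w)).card = (s.filter (· < w)).card ∧
      ((s.erase w).filter (· < v)).card + (if w ∈ s then 1 else 0) =
        (s.filter (· < v)).card := by
  constructor
  · congr 1
    ext t
    simp only [Finset.mem_filter, Finset.mem_erase]
    constructor
    · rintro ⟨⟨_, h1⟩, h2⟩
      exact ⟨h1, h2⟩
    · rintro ⟨h1, h2⟩
      exact ⟨⟨(h2.trans h).ne, h1⟩, h2⟩
  · rw [Finset.filter_erase]
    split_ifs with hw
    · exact Finset.card_erase_add_one (Finset.mem_filter.2 ⟨hw, h⟩)
    · rw [Finset.erase_eq_of_notMem (fun hm => hw (Finset.mem_filter.1 hm).1), add_zero]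

lemma coboundary_comp [LinearOrder V] (K : PreAbstractSimplicialComplex V) (i : ℤ) :
    coboundary K (i + 1) ∘ₗ coboundary K i = 0 := by
  refine LinearMap.ext fun c => funext fun s => ?_
  change ∑ v : s.1, (-1 : ℤ) ^ (s.1.filter (· < (v : V))).card *
    ∑ w : (s.face v).1, (-1 : ℤ) ^ ((s.1.erase v).filter (· < (w : V))).card *
      c ((s.face v).face w) = 0
  simp only [Finset.mul_sum]
  rw [Finset.sum_sigma']
  have hmem : ∀ a : (Σ v : s.1, (s.face v).1), (a.2 : V) ∈ s.1 ∧ (a.2 : V) ≠ a.1 := fun a =>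
    ⟨Finset.mem_of_mem_erase a.2.2, Finset.ne_of_mem_erase a.2.2⟩
  refine Finset.sum_involution
    (fun a _ => ⟨⟨a.2, (hmem a).1⟩, ⟨a.1, Finset.mem_erase.2 ⟨(hmem a).2.symm, a.1.2⟩⟩⟩)
    ?_ ?_ (fun _ _ => Finset.mem_univ _) (fun _ _ => rfl)
  · rintro ⟨⟨v, hv⟩, ⟨w, hw⟩⟩ -
    have hws : w ∈ s.1 := Finset.mem_of_mem_erase hw
    have hne : w ≠ v := Finset.ne_of_mem_erase hw
    have hface : (s.face ⟨v, hv⟩).face ⟨w, hw⟩ =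
        (s.face ⟨w, hws⟩).face ⟨v, Finset.mem_erase.2 ⟨hne.symm, hv⟩⟩ :=
      Subtype.ext (Finset.erase_right_comm)
    dsimp only
    rw [hface]
    rcases lt_or_gt_of_ne hne with h | h
    · obtain ⟨h1, h2⟩ := card_filter_erase s.1 h
      rw [if_pos hws] at h2
      rw [h1, ← h2]
      ring
    · obtain ⟨h1, h2⟩ := card_filter_erase s.1 h
      rw [if_pos hv] at h2
      rw [h1, ← h2]
      ring
  · rintro ⟨⟨v, hv⟩, ⟨w, hw⟩⟩ - _ heq
    exact Finset.ne_of_mem_erase hw (congrArg (fun a => (a.1 : V)) heq)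

/-- The augmented simplicial cochain complex with integral coefficients, the simplices being
oriented by an order of the vertices. -/
def augCochainComplex [LinearOrder V] (K : PreAbstractSimplicialComplex V) :
    CochainComplex (ModuleCat.{u} ℤ) ℤ :=
  CochainComplex.of (fun i => ModuleCat.of ℤ (AugSimplex K i → ℤ))
    (fun i => ModuleCat.ofHom (coboundary K i))
    (fun i => by
      rw [← ModuleCat.ofHom_comp, coboundary_comp]
      rfl)

open Classical in
/-- The reduced integral cohomology of a simplicial complex. The simplices are oriented by an
arbitrary order of the vertices. -/
def reducedCohomology (K : PreAbstractSimplicialComplex V) (i : ℤ) : ModuleCat.{u} ℤ :=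
  letI : LinearOrder V := linearOrderOfSTO (WellOrderingRel (α := V))
  (augCochainComplex K).homology i

end Simplicial

end DualityCategory

end

/-! The constant functor is resolved by the modules `C_i` of simplicial chains, where `C_i(y)` is
the group of `i`-chains on the simplex `y`. As a module `C_i` is the direct sum of the `P_x` over
the simplices `x` of dimension `i`, hence finitely generated projective. At each `y` the augmented
complex is that of a full simplex, which a cone contracts. As there are finitely many simplices,
this gives type `FP`.

Since `P_z(x)` is `ℤ` if `z ⊆ x` and `0` otherwise, `D(C_i)(z)` is the group of functions on the
`i`-simplices that contain `z`. Writing these as `s ∪ z` turns `D(C)(z)`, up to signs, into the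
augmented cochain complex of the link of `z`, shifted by `dim z + 1`. So `D^i(ℤ)(z)` is the reduced
cohomology of the link in degree `i - dim z - 1`, and the hypothesis says that `D(C)` has cohomology
in degree `n` only (`dualShort_exact`). A maximal simplex has empty link, with cohomology `ℤ` in
degree `-1`, so its dimension is `n`; hence `C_i = 0` for `i > n` (`dim_le_of_link`).

Consequently `D(C)`, read backwards from degree `n`, is a projective resolution of `D^n(ℤ)`
(`dualResolution`). For a finitely generated projective `P` the natural map `D(P) ⊗ G ⟶ Hom(P, G)`
is an isomorphism (`DualBasis.isIso_tensorToHom`). The complex that computes `Tor_{n-i}(D^n(ℤ), G)`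
is therefore the one that computes `Ext^i(ℤ, G)`, naturally in `G`. -/

noncomputable section

namespace DualityCategory

/-! ### Finitely generated projective modules, by dual bases -/

section DualBasis

variable {k : Type} [CommRing k] {C : Type u} [SmallCategory C]

lemma ofElement_comp {F G : CMod k C} {x : C} (a : F.obj x) (φ : F ⟶ G) :
    ofElement a ≫ φ = ofElement ((φ.app x).hom a) := by
  refine standardProjective_hom_ext ?_
  rw [ofElement_apply_id]
  exact congrArg (φ.app x).hom (ofElement_apply_id a)

lemma ofElement_eq {F : CMod k C} {x : C} (φ : (standardProjective k C).obj (op x) ⟶ F) :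
    ofElement ((φ.app x).hom (Finsupp.single (𝟙 x) (1 : k))) = φ :=
  standardProjective_hom_ext (ofElement_apply_id _)

/-- The Yoneda lemma: elements of `F(x)` are morphisms `P_x ⟶ F`. -/
def elementEquiv (F : CMod k C) (x : C) :
    F.obj x ≃ₗ[k] ((standardProjective k C).obj (op x) ⟶ F) where
  toFun := ofElement
  invFun φ := (φ.app x).hom (Finsupp.single (𝟙 x) (1 : k))
  left_inv a := ofElement_apply_id a
  right_inv φ := ofElement_eq φ
  map_add' a b := standardProjective_hom_ext <| (ofElement_apply_id _).trans
    (congrArg₂ (· + ·) (ofElement_apply_id a) (ofElement_apply_id b)).symm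
  map_smul' r a := standardProjective_hom_ext <| (ofElement_apply_id _).trans
    (congrArg (r • ·) (ofElement_apply_id a)).symm

lemma map_comp_ofElement {F : CMod k C} {x y : C} (f : x ⟶ y) (a : F.obj x) :
    (standardProjective k C).map f.op ≫ ofElement a = ofElement ((F.map f).hom a) := by
  refine standardProjective_hom_ext ?_
  rw [ofElement_apply_id]
  change Finsupp.linearCombination k (fun f : x ⟶ y => (F.map f).hom a)
    (Finsupp.mapDomain (fun g : y ⟶ y => f ≫ g) (Finsupp.single (𝟙 y) 1)) = _
  simp [Finsupp.mapDomain_single]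

lemma ofElement_single {x y : C} (f : x ⟶ y) :
    ofElement (F := (standardProjective k C).obj (op x)) (x := y)
      (Finsupp.single f (1 : k) : (x ⟶ y) →₀ k) = (standardProjective k C).map f.op := by
  refine standardProjective_hom_ext ((ofElement_apply_id _).trans ?_)
  change _ = Finsupp.mapDomain (fun g : y ⟶ y => f ≫ g) (Finsupp.single (𝟙 y) 1)
  rw [Finsupp.mapDomain_single, Category.comp_id]

lemma ofElement_eq_linearCombination {x y : C} (p : (x ⟶ y) →₀ k) :
    ofElement (F := (standardProjective k C).obj (op x)) (x := y) p =
      Finsupp.linearCombination k (fun f : x ⟶ y => (standardProjective k C).map f.op) p := by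
  have h : (elementEquiv ((standardProjective k C).obj (op x)) y).toLinearMap =
      Finsupp.linearCombination k (fun f : x ⟶ y => (standardProjective k C).map f.op) := by
    refine Finsupp.lhom_ext' fun f => LinearMap.ext_ring ?_
    change ofElement (F := (standardProjective k C).obj (op x)) (x := y)
      (Finsupp.single f (1 : k) : (x ⟶ y) →₀ k) = Finsupp.linearCombination k _
        (Finsupp.single f (1 : k))
    rw [ofElement_single, Finsupp.linearCombination_single, one_smul]
  exact congrArg (fun t => t p) h

/-- A finite dual basis of a module: elements `b_j ∈ F(x_j)` and morphisms `π_j : F ⟶ P_{x_j}`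
such that the identity of `F` is `∑ j, b_j ∘ π_j`. -/
structure DualBasis (F : CMod k C) where
  /-- the index type -/
  ι : Type u
  [fintype : Fintype ι]
  /-- the objects -/
  ob : ι → C
  /-- the elements -/
  elt : ∀ j, F.obj (ob j)
  /-- the coordinates -/
  coord : ∀ j, F ⟶ (standardProjective k C).obj (op (ob j))
  total : ∑ j, coord j ≫ ofElement (elt j) = 𝟙 F

attribute [instance] DualBasis.fintype

namespace DualBasis

variable {F : CMod k C} (B : DualBasis F)

lemma sum_comp {G : CMod k C} (φ : F ⟶ G) :
    ∑ j, B.coord j ≫ ofElement ((φ.app (B.ob j)).hom (B.elt j)) = φ := by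
  calc _ = ∑ j, (B.coord j ≫ ofElement (B.elt j)) ≫ φ :=
        Finset.sum_congr rfl fun j _ => by rw [Category.assoc, ofElement_comp]
    _ = φ := by rw [← Preadditive.sum_comp, B.total, Category.id_comp]

include B in
lemma projective : Projective F where
  factors {E X} f e _ := by
    refine ⟨∑ j, B.coord j ≫ Projective.factorThru (ofElement (B.elt j) ≫ f) e, ?_⟩
    rw [Preadditive.sum_comp]
    simp only [Category.assoc, Projective.factorThru_comp]
    simp only [← Category.assoc]
    rw [← Preadditive.sum_comp, B.total, Category.id_comp]

include B in
lemma isFiniteType : IsFiniteType F := by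
  let e := Fintype.equivFin B.ι
  let p : (∐ fun j : Fin (Fintype.card B.ι) =>
      (standardProjective k C).obj (op (B.ob (e.symm j)))) ⟶ F :=
    Sigma.desc fun j => ofElement (B.elt (e.symm j))
  refine ⟨Fintype.card B.ι, fun j => B.ob (e.symm j), p, ?_⟩
  have hp : (∑ j, B.coord (e.symm j) ≫ Sigma.ι (fun j : Fin (Fintype.card B.ι) =>
      (standardProjective k C).obj (op (B.ob (e.symm j)))) j) ≫ p = 𝟙 F := by
    rw [Preadditive.sum_comp, ← B.total, ← e.symm.sum_comp]
    refine Finset.sum_congr rfl fun j _ => ?_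
    rw [Category.assoc, Sigma.ι_desc]
  exact (SplitEpi.mk _ hp).epi

/-- The coordinates of the dual of a module with a dual basis: evaluation at the elements of the
basis. -/
def dualCoord {x : C} (b : F.obj x) :
    (dual k C).obj (op F) ⟶ (standardProjective k Cᵒᵖ).obj (op (op x)) where
  app z := ModuleCat.ofHom
    { toFun := fun φ : F ⟶ (standardProjective k C).obj (op z.unop) =>
        (Finsupp.mapDomain Quiver.Hom.op
          (show (z.unop ⟶ x) →₀ k from (φ.app x).hom b) : (op x ⟶ z) →₀ k)
      map_add' := fun φ ψ => Finsupp.mapDomain_add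
      map_smul' := fun r φ => Finsupp.mapDomain_smul _ _ }
  naturality z w g := by
    ext φ
    change Finsupp.mapDomain Quiver.Hom.op (Finsupp.mapDomain (fun h : z.unop ⟶ x => g.unop ≫ h)
      (show (z.unop ⟶ x) →₀ k from
        ((show F ⟶ (standardProjective k C).obj (op z.unop) from φ).app x).hom b)) =
      Finsupp.mapDomain (fun h : op x ⟶ z => h ≫ g) (Finsupp.mapDomain Quiver.Hom.op
      (show (z.unop ⟶ x) →₀ k from
        ((show F ⟶ (standardProjective k C).obj (op z.unop) from φ).app x).hom b))
    rw [← Finsupp.mapDomain_comp, ← Finsupp.mapDomain_comp]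
    rfl

/-- For `a = π_j` and `b = b_j` this is one term of the expansion of `φ` in the dual basis. Under
`D` the elements and the coordinates exchange roles. -/
lemma ofElement_dualCoord {x : C} (a : F ⟶ (standardProjective k C).obj (op x)) (b : F.obj x)
    {z : C} (φ : F ⟶ (standardProjective k C).obj (op z)) :
    ((dualCoord b ≫ ofElement (F := (dual k C).obj (op F)) (x := op x) a).app
      (op z)).hom φ = a ≫ ofElement ((φ.app x).hom b) := by
  refine Eq.trans ?_ (congrArg (a ≫ ·) (ofElement_eq_linearCombination
    (show (z ⟶ x) →₀ k from (φ.app x).hom b)).symm)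
  change Finsupp.linearCombination k (fun f : op x ⟶ op z =>
      a ≫ (standardProjective k C).map f) (Finsupp.mapDomain Quiver.Hom.op
        (show (z ⟶ x) →₀ k from (φ.app x).hom b)) = Linear.leftComp k _ a _
  rw [Finsupp.linearCombination_mapDomain, Finsupp.apply_linearCombination]
  rfl

/-- The dual of a module with a dual basis has a dual basis. -/
def toDual : DualBasis ((dual k C).obj (op F)) where
  ι := B.ι
  ob j := op (B.ob j)
  elt j := B.coord j
  coord j := dualCoord (B.elt j)
  total := by
    ext z : 2
    refine ModuleCat.hom_ext (LinearMap.ext fun φ => ?_)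
    rw [NatTrans.app_sum, ModuleCat.hom_sum, LinearMap.sum_apply]
    refine Eq.trans (Finset.sum_congr rfl fun j _ => ?_) (B.sum_comp φ)
    exact ofElement_dualCoord (B.coord j) (B.elt j) φ

end DualBasis

end DualBasis

/-! ### The isomorphism `D(F) ⊗ G ≅ Hom(F, G)` for finitely generated projective `F` -/

section TensorHom

variable {k : Type} [CommRing k] {C : Type u} [SmallCategory C]

/-- The class of `a ⊗ b` in the tensor product over `C`. -/
def tensorMk (F : CMod k Cᵒᵖ) (G : CMod k C) (x : C) :
    F.obj (op x) →ₗ[k] G.obj x →ₗ[k] (TensorSum F G ⧸ tensorRel F G) := by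
  classical
  exact (TensorProduct.mk k (F.obj (op x)) (G.obj x)).compr₂
    ((tensorRel F G).mkQ ∘ₗ DirectSum.lof k C (fun z => F.obj (op z) ⊗[k] G.obj z) x)

lemma tensorMk_map {F : CMod k Cᵒᵖ} {G : CMod k C} {x y : C} (f : x ⟶ y) (a : F.obj (op y))
    (b : G.obj x) :
    tensorMk F G x ((F.map f.op).hom a) b = tensorMk F G y a ((G.map f).hom b) := by
  classical
  exact (Submodule.Quotient.eq _).2 (Submodule.subset_span ⟨x, y, f, a, b, rfl⟩)

lemma tensor_hom_ext {F : CMod k Cᵒᵖ} {G : CMod k C} {M : Type*} [AddCommGroup M] [Module k M]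
    {α β : (TensorSum F G ⧸ tensorRel F G) →ₗ[k] M}
    (h : ∀ x (a : F.obj (op x)) (b : G.obj x),
      α (tensorMk F G x a b) = β (tensorMk F G x a b)) : α = β := by
  classical
  refine Submodule.linearMap_qext _ (DirectSum.linearMap_ext _ fun x =>
    TensorProduct.ext' fun a b => ?_)
  exact h x a b

lemma tensorMap_tensorMk {F F' : CMod k Cᵒᵖ} {G G' : CMod k C} (φ : F ⟶ F') (ψ : G ⟶ G')
    (x : C) (a : F.obj (op x)) (b : G.obj x) :
    (tensorMap φ ψ).hom (tensorMk F G x a b) =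
      tensorMk F' G' x ((φ.app (op x)).hom a) ((ψ.app x).hom b) := by
  classical
  change Submodule.Quotient.mk (tensorSumMap φ ψ (DirectSum.lof k C _ x (a ⊗ₜ b))) = _
  rw [tensorSumMap, DirectSum.lmap_lof, TensorProduct.map_tmul]
  rfl

variable (F G : CMod k C)

/-- The class of `φ ⊗ b` in `D(F) ⊗_C G`, for `φ : F ⟶ P_x` and `b ∈ G(x)`. -/
def dualTensorMk (x : C) :
    (F ⟶ (standardProjective k C).obj (op x)) →ₗ[k] G.obj x →ₗ[k]
      (TensorSum ((dual k C).obj (op F)) G ⧸ tensorRel ((dual k C).obj (op F)) G) :=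
  tensorMk ((dual k C).obj (op F)) G x

variable {F G} in
lemma dual_tensor_hom_ext {M : Type*} [AddCommGroup M] [Module k M]
    {α β : (TensorSum ((dual k C).obj (op F)) G ⧸ tensorRel ((dual k C).obj (op F)) G) →ₗ[k] M}
    (h : ∀ x (φ : F ⟶ (standardProjective k C).obj (op x)) (b : G.obj x),
      α (dualTensorMk F G x φ b) = β (dualTensorMk F G x φ b)) : α = β :=
  tensor_hom_ext h

/-- The bilinear map `(φ, b) ↦ (F ⟶ P_x ⟶ G)`. -/
def dualPairing (x : C) :
    (F ⟶ (standardProjective k C).obj (op x)) →ₗ[k] G.obj x →ₗ[k] (F ⟶ G) :=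
  LinearMap.mk₂ k (fun φ b => φ ≫ elementEquiv G x b)
    (fun φ ψ b => Preadditive.add_comp _ _ _ _ _ _)
    (fun r φ b => Linear.smul_comp _ _ _ _ _ _)
    (fun φ b c => by rw [map_add, Preadditive.comp_add])
    (fun r φ b => by rw [map_smul, Linear.comp_smul])

open Classical in
/-- The linear map underlying `D(F) ⊗_C G ⟶ Hom(F, G)`. -/
def tensorToHomLinear :
    (TensorSum ((dual k C).obj (op F)) G ⧸ tensorRel ((dual k C).obj (op F)) G) →ₗ[k] (F ⟶ G) :=
  Submodule.liftQ _
    (DirectSum.toModule k C (F ⟶ G) fun x => TensorProduct.lift (dualPairing F G x)) <| by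
      refine Submodule.span_le.2 ?_
      rintro _ ⟨x, y, f, a, b, rfl⟩
      rw [SetLike.mem_coe, LinearMap.mem_ker, map_sub, DirectSum.toModule_lof,
        DirectSum.toModule_lof, sub_eq_zero]
      change ((show F ⟶ (standardProjective k C).obj (op y) from a) ≫
        (standardProjective k C).map f.op) ≫ ofElement b =
        (show F ⟶ (standardProjective k C).obj (op y) from a) ≫ ofElement _
      rw [Category.assoc, map_comp_ofElement]

/-- The natural map `D(F) ⊗_C G ⟶ Hom(F, G)`. -/
def tensorToHom :
    ((tensor k C).obj ((dual k C).obj (op F))).obj G ⟶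
      ((linearYoneda k (CMod k C)).obj G).obj (op F) :=
  ModuleCat.ofHom (tensorToHomLinear F G)

lemma tensorToHomLinear_mk (x : C) (φ : F ⟶ (standardProjective k C).obj (op x)) (b : G.obj x) :
    tensorToHomLinear F G (dualTensorMk F G x φ b) = φ ≫ ofElement b := by
  classical
  change DirectSum.toModule k C (F ⟶ G) (fun x => TensorProduct.lift (dualPairing F G x))
    (DirectSum.lof k C (fun z => (F ⟶ (standardProjective k C).obj (op z)) ⊗[k] G.obj z) x
      (φ ⊗ₜ b)) = _
  exact DirectSum.toModule_lof _ _ _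

/-- The defining relation of the tensor product for a morphism `f : x ⟶ y`, extended linearly to `p
∈ k[Hom(x, y)]`. -/
lemma dualTensorMk_ofElement {x y : C}
    (a : F ⟶ (standardProjective k C).obj (op y)) (b : G.obj x)
    (p : ((standardProjective k C).obj (op x)).obj y) :
    dualTensorMk F G y a (((ofElement b).app y).hom p) =
      dualTensorMk F G x (a ≫ ofElement p) b := by
  let α : ((x ⟶ y) →₀ k) →ₗ[k] _ := (dualTensorMk F G y a) ∘ₗ ((ofElement b).app y).hom
  let β : ((x ⟶ y) →₀ k) →ₗ[k] _ :=
    ((dualTensorMk F G x).flip b) ∘ₗ (Linear.leftComp k _ a) ∘ₗ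
      (elementEquiv ((standardProjective k C).obj (op x)) y).toLinearMap
  have h : α = β := by
    refine Finsupp.lhom_ext' fun f => LinearMap.ext_ring ?_
    change dualTensorMk F G y a
      (Finsupp.linearCombination k (fun f : x ⟶ y => (G.map f).hom b) (Finsupp.single f 1)) =
      dualTensorMk F G x
        (a ≫ ofElement (F := (standardProjective k C).obj (op x)) (x := y)
          (Finsupp.single f (1 : k) : (x ⟶ y) →₀ k)) b
    rw [ofElement_single, Finsupp.linearCombination_single, one_smul]
    exact (tensorMk_map (F := (dual k C).obj (op F)) f a b).symm
  exact congrArg (fun t => t p) h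

variable {F} in
/-- The inverse of `D(F) ⊗_C G ⟶ Hom(F, G)` for a module with a dual basis. -/
def DualBasis.homToTensor (B : DualBasis F) :
    (F ⟶ G) →ₗ[k] (TensorSum ((dual k C).obj (op F)) G ⧸ tensorRel ((dual k C).obj (op F)) G) :=
  ∑ j, dualTensorMk F G (B.ob j) (B.coord j) ∘ₗ
    { toFun := fun θ => (θ.app (B.ob j)).hom (B.elt j)
      map_add' := fun _ _ => rfl
      map_smul' := fun _ _ => rfl }

variable {F} in
lemma DualBasis.homToTensor_apply (B : DualBasis F) (θ : F ⟶ G) :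
    B.homToTensor G θ = ∑ j, dualTensorMk F G (B.ob j) (B.coord j)
      ((θ.app (B.ob j)).hom (B.elt j)) := by
  simp [homToTensor]

variable {F} in
-- The inverse is `θ ↦ ∑ π_j ⊗ θ(b_j)`. Applied to the image of `φ ⊗ b`, the coefficients `φ(b_j)`
-- move across the tensor sign, and the expansion of `φ` in the dual basis remains.
lemma DualBasis.isIso_tensorToHom (B : DualBasis F) : IsIso (tensorToHom F G) := by
  refine ⟨ModuleCat.ofHom (B.homToTensor G), ModuleCat.hom_ext (dual_tensor_hom_ext ?_),
    ModuleCat.hom_ext (LinearMap.ext ?_)⟩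
  · intro x φ b
    change B.homToTensor G (tensorToHomLinear F G (dualTensorMk F G x φ b)) =
      dualTensorMk F G x φ b
    rw [tensorToHomLinear_mk, B.homToTensor_apply]
    conv_rhs => rw [← B.sum_comp φ, map_sum, LinearMap.sum_apply]
    exact Finset.sum_congr rfl fun j _ => dualTensorMk_ofElement F G _ _ _
  · intro (θ : F ⟶ G)
    change tensorToHomLinear F G (B.homToTensor G θ) = θ
    rw [B.homToTensor_apply, map_sum]
    refine Eq.trans (Finset.sum_congr rfl fun j _ => ?_) (B.sum_comp θ)
    exact tensorToHomLinear_mk F G _ _ _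

variable {F G}

lemma tensorToHom_naturality_left {F' : CMod k C} (φ : F ⟶ F') :
    ((tensor k C).map ((dual k C).map φ.op)).app G ≫ tensorToHom F G =
      tensorToHom F' G ≫ ((linearYoneda k (CMod k C)).obj G).map φ.op := by
  refine ModuleCat.hom_ext (dual_tensor_hom_ext ?_)
  intro x a b
  have h : (tensorMap ((dual k C).map φ.op) (𝟙 G)).hom (dualTensorMk F' G x a b) =
    dualTensorMk F G x (φ ≫ a) b := tensorMap_tensorMk _ _ x _ b
  change tensorToHomLinear F G ((tensorMap ((dual k C).map φ.op) (𝟙 G)).hom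
    (dualTensorMk F' G x a b)) = φ ≫ tensorToHomLinear F' G (dualTensorMk F' G x a b)
  rw [h, tensorToHomLinear_mk, tensorToHomLinear_mk, Category.assoc]

lemma tensorToHom_naturality_right {G' : CMod k C} (ψ : G ⟶ G') :
    ((tensor k C).obj ((dual k C).obj (op F))).map ψ ≫ tensorToHom F G' =
      tensorToHom F G ≫ ((linearYoneda k (CMod k C)).map ψ).app (op F) := by
  refine ModuleCat.hom_ext (dual_tensor_hom_ext ?_)
  intro x a b
  have h : (tensorMap (𝟙 ((dual k C).obj (op F))) ψ).hom (dualTensorMk F G x a b) =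
    dualTensorMk F G' x a ((ψ.app x).hom b) := tensorMap_tensorMk _ _ x _ b
  change tensorToHomLinear F G' ((tensorMap (𝟙 _) ψ).hom (dualTensorMk F G x a b)) =
    tensorToHomLinear F G (dualTensorMk F G x a b) ≫ ψ
  rw [h, tensorToHomLinear_mk, tensorToHomLinear_mk, Category.assoc, ofElement_comp]

end TensorHom

/-! ### Chains on a simplex and their contraction -/

section SimplexChains

variable {V : Type u}

/-- The chains of dimension `i` on the nonempty faces of `y`. -/
def simplexChains (i : ℤ) (y : Finset V) : Submodule ℤ (Finset V →₀ ℤ) :=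
  Finsupp.supported ℤ ℤ {x | x.Nonempty ∧ x ⊆ y ∧ dim x = i}

lemma single_mem_simplexChains {i : ℤ} {x y : Finset V} (hx : x.Nonempty) (hxy : x ⊆ y)
    (hi : dim x = i) : Finsupp.single x 1 ∈ simplexChains i y :=
  Finsupp.single_mem_supported ℤ 1 ⟨hx, hxy, hi⟩

lemma simplexChains_mono (i : ℤ) {y z : Finset V} (h : y ⊆ z) :
    simplexChains i y ≤ simplexChains i z :=
  Finsupp.supported_mono fun _ hx => ⟨hx.1, hx.2.1.trans h, hx.2.2⟩

lemma simplexChains_induction {i : ℤ} {y : Finset V} {M : Type*} [AddCommGroup M]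
    {f g : (Finset V →₀ ℤ) →ₗ[ℤ] M}
    (h : ∀ x : Finset V, x.Nonempty → x ⊆ y → dim x = i →
      f (Finsupp.single x 1) = g (Finsupp.single x 1))
    {c : Finset V →₀ ℤ} (hc : c ∈ simplexChains i y) : f c = g c := by
  rw [simplexChains, Finsupp.supported_eq_span_single] at hc
  refine LinearMap.eqOn_span ?_ hc
  rintro _ ⟨x, hx, rfl⟩
  exact h x hx.1 hx.2.1 hx.2.2

lemma simplexChains_le_comap {i j : ℤ} {y : Finset V}
    {f : (Finset V →₀ ℤ) →ₗ[ℤ] (Finset V →₀ ℤ)}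
    (h : ∀ x : Finset V, x.Nonempty → x ⊆ y → dim x = i →
      f (Finsupp.single x 1) ∈ simplexChains j y) :
    simplexChains i y ≤ (simplexChains j y).comap f := by
  conv_lhs => rw [simplexChains, Finsupp.supported_eq_span_single]
  refine Submodule.span_le.2 ?_
  rintro _ ⟨x, hx, rfl⟩
  exact h x hx.1 hx.2.1 hx.2.2

lemma dim_nonneg {s : Finset V} (hs : s.Nonempty) : 0 ≤ dim s := by
  have h := hs.card_pos
  simp only [dim]
  omega

end SimplexChains

section Chains

variable {V : Type u} [LinearOrder V]

/-- The sign of the face of `s` opposite to `v`. -/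
def faceSign (s : Finset V) (v : V) : ℤ := (-1) ^ (s.filter (· < v)).card

lemma faceSign_mul_self (s : Finset V) (v : V) : faceSign s v * faceSign s v = 1 := by
  rw [faceSign, ← mul_pow]
  simp

/-- Deleting the smaller vertex `w` lowers the position of `v` by one, while deleting `v` does not
move `w`. This is the sign behind `∂∂ = 0`. -/
lemma faceSign_erase_of_lt {s : Finset V} {v w : V} (hw : w ∈ s) (h : w < v) :
    faceSign s v * faceSign (s.erase v) w = -(faceSign s w * faceSign (s.erase w) v) := by
  obtain ⟨h1, h2⟩ := card_filter_erase s h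
  rw [if_pos hw] at h2
  simp only [faceSign, h1, ← h2]
  ring

lemma faceSign_erase {s : Finset V} {v w : V} (hv : v ∈ s) (hw : w ∈ s) (h : w ≠ v) :
    faceSign s v * faceSign (s.erase v) w = -(faceSign s w * faceSign (s.erase w) v) := by
  rcases lt_or_gt_of_ne h with h | h
  · exact faceSign_erase_of_lt hw h
  · rw [faceSign_erase_of_lt hv h, neg_neg]

lemma sum_faceSign_faceSign {M : Type*} [AddCommGroup M] (s : Finset V) (f : Finset V → M) :
    ∑ v ∈ s, ∑ w ∈ s.erase v,
      (faceSign s v * faceSign (s.erase v) w) • f ((s.erase v).erase w) = 0 := by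
  rw [Finset.sum_sigma']
  refine Finset.sum_involution (fun a _ => ⟨a.2, a.1⟩) ?_ ?_ ?_ (fun _ _ => rfl)
  · rintro ⟨v, w⟩ h
    obtain ⟨hv, hw⟩ := Finset.mem_sigma.1 h
    obtain ⟨hne, hw⟩ := Finset.mem_erase.1 hw
    dsimp only at hv hw hne ⊢
    rw [faceSign_erase hv hw hne, Finset.erase_right_comm, neg_smul, neg_add_cancel]
  · rintro ⟨v, w⟩ h _ heq
    exact Finset.ne_of_mem_erase (Finset.mem_sigma.1 h).2 (congrArg Sigma.fst heq)
  · rintro ⟨v, w⟩ h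
    obtain ⟨hv, hw⟩ := Finset.mem_sigma.1 h
    obtain ⟨hne, hw⟩ := Finset.mem_erase.1 hw
    exact Finset.mem_sigma.2 ⟨hw, Finset.mem_erase.2 ⟨hne.symm, hv⟩⟩

/-- The alternating sum of the values of `f` on the faces of a simplex. -/
def boundarySum {M : Type*} [AddCommGroup M] (f : Finset V → M) (s : Finset V) : M :=
  ∑ v ∈ s, faceSign s v • f (s.erase v)

/-- The boundary of chains on all finite subsets, the empty set included. -/
def augBoundary : (Finset V →₀ ℤ) →ₗ[ℤ] (Finset V →₀ ℤ) :=
  Finsupp.linearCombination ℤ (boundarySum fun t => Finsupp.single t 1)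

/-- The projection that kills the empty simplex. -/
def killEmpty : (Finset V →₀ ℤ) →ₗ[ℤ] (Finset V →₀ ℤ) :=
  Finsupp.linearCombination ℤ fun t => if t = ∅ then 0 else Finsupp.single t 1

/-- The boundary of chains of nonempty simplices. -/
def boundary : (Finset V →₀ ℤ) →ₗ[ℤ] (Finset V →₀ ℤ) := killEmpty ∘ₗ augBoundary

/-- The cone over a chain with apex `v`. -/
def cone (v : V) : (Finset V →₀ ℤ) →ₗ[ℤ] (Finset V →₀ ℤ) :=
  Finsupp.linearCombination ℤ fun t => if v ∈ t then 0 else Finsupp.single (insert v t) 1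

@[simp]
lemma augBoundary_single (s : Finset V) :
    augBoundary (Finsupp.single s 1) = boundarySum (fun t => Finsupp.single t (1 : ℤ)) s := by
  simp [augBoundary]

@[simp]
lemma killEmpty_single (s : Finset V) :
    killEmpty (Finsupp.single s (1 : ℤ)) = if s = ∅ then 0 else Finsupp.single s 1 := by
  simp [killEmpty]

lemma map_boundarySum {M N : Type*} [AddCommGroup M] [AddCommGroup N] (g : M →ₗ[ℤ] N)
    (f : Finset V → M) (s : Finset V) : g (boundarySum f s) = boundarySum (fun t => g (f t)) s := by
  simp [boundarySum, map_sum]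

lemma boundary_single (s : Finset V) :
    boundary (Finsupp.single s 1) =
      boundarySum (fun t => if t = ∅ then 0 else Finsupp.single t (1 : ℤ)) s := by
  simp [boundary, map_boundarySum]

@[simp]
lemma cone_single (v : V) (s : Finset V) :
    cone v (Finsupp.single s (1 : ℤ)) =
      if v ∈ s then 0 else Finsupp.single (insert v s) 1 := by
  simp [cone]

/-- The empty simplex has zero boundary. This reduces `∂∂ = 0` for chains of nonempty simplices to
the augmented case. -/
lemma augBoundary_killEmpty (c : Finset V →₀ ℤ) : augBoundary (killEmpty c) = augBoundary c := by
  have h : augBoundary ∘ₗ killEmpty = (augBoundary : (Finset V →₀ ℤ) →ₗ[ℤ] _) := by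
    refine Finsupp.lhom_ext' fun s => LinearMap.ext_ring ?_
    by_cases hs : s = ∅
    · subst hs
      simp [boundarySum]
    · simp [hs]
  exact congrArg (fun t => t c) h

lemma augBoundary_augBoundary (c : Finset V →₀ ℤ) : augBoundary (augBoundary c) = 0 := by
  have h : augBoundary ∘ₗ augBoundary = (0 : (Finset V →₀ ℤ) →ₗ[ℤ] (Finset V →₀ ℤ)) := by
    refine Finsupp.lhom_ext' fun s => LinearMap.ext_ring ?_
    simp only [LinearMap.coe_comp, Function.comp_apply, Finsupp.lsingle_apply, augBoundary_single,
      map_boundarySum, LinearMap.zero_apply]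
    refine Eq.trans (Finset.sum_congr rfl fun v _ => ?_)
      (sum_faceSign_faceSign s fun t => Finsupp.single t (1 : ℤ))
    beta_reduce
    rw [boundarySum, Finset.smul_sum]
    exact Finset.sum_congr rfl fun w _ => smul_smul _ _ _
  exact congrArg (fun t => t c) h

lemma boundary_boundary (c : Finset V →₀ ℤ) : boundary (boundary c) = 0 := by
  simp only [boundary, LinearMap.comp_apply, augBoundary_killEmpty, augBoundary_augBoundary,
    map_zero]

/-- The cone is a contracting homotopy of the augmented complex. The apex precedes the vertices of
`s`, so inserting it costs no sign. -/
lemma cone_augBoundary_single {v : V} {s : Finset V} (hs : ∀ w ∈ s, v ≤ w) :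
    augBoundary (cone v (Finsupp.single s 1)) + cone v (augBoundary (Finsupp.single s 1)) =
      Finsupp.single s (1 : ℤ) := by
  have hv1 : ∀ t : Finset V, (∀ w ∈ t, v ≤ w) → faceSign t v = 1 := by
    intro t ht
    rw [faceSign, Finset.filter_false_of_mem fun w hw => not_lt.2 (ht w hw), Finset.card_empty,
      pow_zero]
  rw [augBoundary_single, map_boundarySum, cone_single]
  by_cases hv : v ∈ s
  -- Here the cone over `s` is zero, and only the face opposite to `v` has a nonzero cone.
  · rw [if_pos hv, map_zero, zero_add, boundarySum, Finset.sum_eq_single_of_mem v hv]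
    · rw [hv1 s hs, one_smul, cone_single, if_neg (Finset.notMem_erase v s),
        Finset.insert_erase hv]
    · intro w _ hwv
      rw [cone_single, if_pos (Finset.mem_erase.2 ⟨hwv.symm, hv⟩), smul_zero]
  · have hins : ∀ w ∈ insert v s, v ≤ w := by
      intro w hw
      rcases Finset.mem_insert.1 hw with rfl | hw
      · exact le_rfl
      · exact hs w hw
    rw [if_neg hv, augBoundary_single, boundarySum, Finset.sum_insert hv, hv1 _ hins, one_smul,
      Finset.erase_insert hv, add_assoc, boundarySum, ← Finset.sum_add_distrib,
      Finset.sum_eq_zero, add_zero]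
    intro w hw
    have hwv : w ≠ v := fun h => hv (h ▸ hw)
    have hlt : v < w := lt_of_le_of_ne (hs w hw) hwv.symm
    -- The new first vertex moves every other vertex up by one place, so the faces through `v`
    -- cancel the cone over the boundary of `s`.
    have hsign : faceSign (insert v s) w = -faceSign s w := by
      have := faceSign_erase_of_lt (Finset.mem_insert_self v s) hlt
      rw [hv1 _ hins, hv1 _ fun u hu => hins u (Finset.mem_of_mem_erase hu),
        Finset.erase_insert hv, mul_one, one_mul] at this
      exact this
    rw [cone_single, if_neg fun h => hv (Finset.mem_of_mem_erase h), hsign,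
      Finset.erase_insert_of_ne hwv.symm, neg_smul, neg_add_cancel]

lemma dim_erase {s : Finset V} {v : V} (hv : v ∈ s) : dim (s.erase v) + 1 = dim s := by
  have h := Finset.card_erase_add_one hv
  simp only [dim]
  omega

lemma dim_insert {s : Finset V} {v : V} (hv : v ∉ s) : dim (insert v s) = dim s + 1 := by
  simp only [dim, Finset.card_insert_of_notMem hv]
  push_cast
  ring

lemma boundary_mem {i j : ℤ} (h : j + 1 = i) {y : Finset V} :
    simplexChains i y ≤ (simplexChains j y).comap boundary := by
  refine simplexChains_le_comap fun x _ hxy hi => ?_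
  rw [boundary_single, boundarySum]
  refine Submodule.sum_mem _ fun v hv => Submodule.smul_mem _ _ ?_
  split_ifs with he
  · exact Submodule.zero_mem _
  · refine single_mem_simplexChains (Finset.nonempty_iff_ne_empty.2 he)
      ((Finset.erase_subset _ _).trans hxy) ?_
    have := dim_erase hv
    omega

lemma cone_mem {i j : ℤ} (h : i + 1 = j) {y : Finset V} {v : V} (hv : v ∈ y) :
    simplexChains i y ≤ (simplexChains j y).comap (cone v) := by
  refine simplexChains_le_comap fun x _ hxy hi => ?_
  rw [cone_single]
  split_ifs with he
  · exact Submodule.zero_mem _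
  · refine single_mem_simplexChains (Finset.insert_nonempty _ _) (Finset.insert_subset hv hxy) ?_
    rw [dim_insert he]
    omega

lemma augBoundary_eq_boundary {i : ℤ} (hi : i ≠ 0) {y : Finset V} {c : Finset V →₀ ℤ}
    (hc : c ∈ simplexChains i y) : augBoundary c = boundary c := by
  refine simplexChains_induction (fun x _ _ hx => ?_) hc
  rw [augBoundary_single, boundary_single]
  refine Finset.sum_congr rfl fun v hv => ?_
  beta_reduce
  rw [if_neg]
  intro he
  have h := dim_erase hv
  rw [he, dim, Finset.card_empty] at h
  push_cast at h
  omega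

lemma augBoundary_eq_single_empty {y : Finset V} {c : Finset V →₀ ℤ}
    (hc : c ∈ simplexChains 0 y) :
    augBoundary c = Finsupp.single ∅ (Finsupp.linearCombination ℤ (fun _ => (1 : ℤ)) c) := by
  refine simplexChains_induction (f := augBoundary) (g := Finsupp.lsingle ∅ ∘ₗ
    Finsupp.linearCombination ℤ (fun _ => (1 : ℤ))) (fun x hx _ hd => ?_) hc
  obtain ⟨v, rfl⟩ : ∃ v, x = {v} := by
    rw [← Finset.card_eq_one]
    simp only [dim] at hd
    omega
  simp [boundarySum, faceSign, Finset.filter_singleton]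

/-- The cone whose apex is the least vertex of `y` fills the cycle. The hypothesis uses the
augmented boundary in order to cover also dimension zero, where `augBoundary` is the augmentation.
-/
lemma exists_boundary_eq_of_augBoundary_eq_zero {i j : ℤ} (hj : i + 1 = j) {y : Finset V}
    (hy : y.Nonempty) {c : Finset V →₀ ℤ} (hc : c ∈ simplexChains i y)
    (h0 : augBoundary c = 0) : ∃ b ∈ simplexChains j y, boundary b = c := by
  have hv := y.min'_mem hy
  set v := y.min' hy
  refine ⟨cone v c, cone_mem hj hv hc, ?_⟩
  have h1 : augBoundary (cone v c) + cone v (augBoundary c) = c := by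
    refine simplexChains_induction (f := augBoundary ∘ₗ cone v + cone v ∘ₗ augBoundary)
      (g := LinearMap.id) (fun x _ hxy _ => ?_) hc
    exact cone_augBoundary_single fun w hw => y.min'_le w (hxy hw)
  rw [h0, map_zero, add_zero] at h1
  rw [boundary, LinearMap.comp_apply, h1]
  refine simplexChains_induction (f := killEmpty) (g := LinearMap.id) (fun x hx _ _ => ?_) hc
  rw [killEmpty_single, if_neg hx.ne_empty]
  rfl

lemma exists_boundary_eq {i j : ℤ} (hi : i ≠ 0) (hj : i + 1 = j) {y : Finset V}
    (hy : y.Nonempty) {c : Finset V →₀ ℤ} (hc : c ∈ simplexChains i y) (h0 : boundary c = 0) :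
    ∃ b ∈ simplexChains j y, boundary b = c :=
  exists_boundary_eq_of_augBoundary_eq_zero hj hy hc ((augBoundary_eq_boundary hi hc).trans h0)

end Chains

/-! ### Cochains on the simplices containing `z` and the cohomology of the link -/

section Cochains

variable {V : Type u} [LinearOrder V]

lemma coboundary_apply (L : PreAbstractSimplicialComplex V) (i : ℤ) (b : AugSimplex L i → ℤ)
    (b' : Finset V → ℤ) (hb : ∀ s : AugSimplex L i, b' s.1 = b s) (s : AugSimplex L (i + 1)) :
    coboundary L i b s = boundarySum b' s.1 := by
  rw [boundarySum, ← Finset.sum_coe_sort]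
  refine Finset.sum_congr rfl fun v _ => ?_
  rw [← hb (s.face v), smul_eq_mul]
  rfl

lemma coboundary_exact {L : PreAbstractSimplicialComplex V} {i : ℤ}
    (h : IsZero ((augCochainComplex L).homology (i + 1))) {c : AugSimplex L (i + 1) → ℤ}
    (hc : coboundary L (i + 1) c = 0) : ∃ b, coboundary L i b = c := by
  rw [← HomologicalComplex.exactAt_iff_isZero_homology,
    HomologicalComplex.exactAt_iff' _ i (i + 1) (i + 1 + 1) (by simp) (by simp),
    ShortComplex.moduleCat_exact_iff] at h
  have hd : ∀ j, (augCochainComplex L).d j (j + 1) = ModuleCat.ofHom (coboundary L j) := fun j =>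
    CochainComplex.of_d (fun i => ModuleCat.of ℤ (AugSimplex L i → ℤ))
      (fun i => ModuleCat.ofHom (coboundary L i)) j
  obtain ⟨b, hb⟩ := h c (by
    change ((augCochainComplex L).d (i + 1) (i + 1 + 1)).hom c = 0
    rw [hd]
    exact hc)
  refine ⟨b, ?_⟩
  change ((augCochainComplex L).d i (i + 1)).hom b = c at hb
  rw [hd] at hb
  exact hb

/-- Cochains become functions on all finite sets, of which only the values on simplices matter, so
that those of a link and those of the whole complex have the same type. -/
lemma exists_eq_boundarySum {L : PreAbstractSimplicialComplex V} {i : ℤ}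
    (h : IsZero ((augCochainComplex L).homology i)) (c : Finset V → ℤ)
    (hc : ∀ s, (s = ∅ ∨ s ∈ L.faces) → dim s = i + 1 → boundarySum c s = 0) :
    ∃ b : Finset V → ℤ, ∀ s, (s = ∅ ∨ s ∈ L.faces) → dim s = i → c s = boundarySum b s := by
  classical
  obtain ⟨i, rfl⟩ : ∃ j, i = j + 1 := ⟨i - 1, by ring⟩
  obtain ⟨b, hb⟩ := coboundary_exact (c := fun s => c s.1) h (funext fun s =>
    (coboundary_apply L (i + 1) _ c (fun _ => rfl) s).trans (hc s.1 s.2.1 s.2.2))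
  let b' : Finset V → ℤ := fun t =>
    if ht : (t = ∅ ∨ t ∈ L.faces) ∧ dim t = i then b ⟨t, ht⟩ else 0
  refine ⟨b', fun s hs hd => ?_⟩
  rw [← coboundary_apply L i b b' (fun t => dif_pos t.2) ⟨s, hs, hd⟩, hb]

/-- The sign that compares the orientations of `s` and `s ∪ z`. -/
def linkSign (z s : Finset V) : ℤ := ∏ v ∈ s, faceSign z v

lemma linkSign_mul_self (z s : Finset V) : linkSign z s * linkSign z s = 1 := by
  rw [linkSign, ← Finset.prod_mul_distrib]
  exact Finset.prod_eq_one fun v _ => faceSign_mul_self z v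

/-- The number of vertices before `v` in `s ∪ z` is the sum of the numbers in `s` and in `z`; the
part from `z` is the factor of `v` in `linkSign z s`. -/
lemma linkSign_mul_faceSign {z s : Finset V} (h : Disjoint s z) {v : V} (hv : v ∈ s) :
    linkSign z s * faceSign (s ∪ z) v = faceSign s v * linkSign z (s.erase v) := by
  have h1 : faceSign (s ∪ z) v = faceSign s v * faceSign z v := by
    rw [faceSign, faceSign, faceSign, ← pow_add, Finset.filter_union,
      Finset.card_union_of_disjoint (Finset.disjoint_filter_filter h)]
  have h2 : linkSign z s = faceSign z v * linkSign z (s.erase v) :=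
    (Finset.mul_prod_erase s _ hv).symm
  rw [h1, h2]
  linear_combination faceSign s v * linkSign z (s.erase v) * faceSign_mul_self z v

lemma erase_union_eq {z s : Finset V} (h : Disjoint s z) {v : V} (hv : v ∈ s) :
    (s ∪ z).erase v = s.erase v ∪ z := by
  rw [Finset.erase_union_distrib, Finset.erase_eq_of_notMem (Finset.disjoint_left.1 h hv)]

/-- Faces opposite to vertices of `z` no longer contain `z` and drop out; the others come from faces
of `s`. So passing to the link, with the sign, commutes with the coboundaries. -/
lemma boundarySum_union {z s : Finset V} (h : Disjoint s z) {c : Finset V → ℤ}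
    (hc : ∀ x, ¬z ⊆ x → c x = 0) :
    linkSign z s * boundarySum c (s ∪ z) =
      boundarySum (fun t => linkSign z t * c (t ∪ z)) s := by
  have h0 : boundarySum c (s ∪ z) = ∑ v ∈ s, faceSign (s ∪ z) v • c ((s ∪ z).erase v) := by
    refine (Finset.sum_subset Finset.subset_union_left fun v hv hvs => ?_).symm
    have hvz : v ∈ z := (Finset.mem_union.1 hv).resolve_left hvs
    rw [hc _ fun hz => Finset.notMem_erase v _ (hz hvz), smul_zero]
  rw [h0, Finset.mul_sum, boundarySum]
  refine Finset.sum_congr rfl fun v hv => ?_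
  rw [erase_union_eq h hv, smul_eq_mul, smul_eq_mul, ← mul_assoc, linkSign_mul_faceSign h hv,
    mul_assoc]

lemma dim_union {z s : Finset V} (h : Disjoint s z) : dim (s ∪ z) = dim s + dim z + 1 := by
  simp only [dim, Finset.card_union_of_disjoint h]
  push_cast
  ring

lemma eq_empty_or_mem_link_iff {K : PreAbstractSimplicialComplex V} {z : Finset V}
    (hz : z ∈ K.faces) (s : Finset V) :
    (s = ∅ ∨ s ∈ (link K z).faces) ↔ Disjoint s z ∧ s ∪ z ∈ K.faces := by
  have key : s ∈ (link K z).faces ↔ s.Nonempty ∧ Disjoint s z ∧ s ∪ z ∈ K.faces := by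
    simp only [link, Set.mem_ofPred_eq]
    convert Iff.rfl
  rw [key]
  rcases s.eq_empty_or_nonempty with rfl | hs
  · simp [hz]
  · simp [hs, hs.ne_empty]

/-- The vanishing of the cohomology of the link of `z`, in terms of cochains on the simplices that
contain `z`. -/
lemma exists_eq_boundarySum_of_link {K : PreAbstractSimplicialComplex V} {z : Finset V}
    (hz : z ∈ K.faces) {i : ℤ}
    (h : IsZero ((augCochainComplex (link K z)).homology (i - dim z - 1))) (c : Finset V → ℤ)
    (hc0 : ∀ x, ¬z ⊆ x → c x = 0)
    (hc : ∀ x ∈ K.faces, dim x = i + 1 → boundarySum c x = 0) :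
    ∃ b : Finset V → ℤ, (∀ x, ¬z ⊆ x → b x = 0) ∧
      ∀ x ∈ K.faces, dim x = i → c x = boundarySum b x := by
  obtain ⟨b, hb⟩ := exists_eq_boundarySum h (fun t => linkSign z t * c (t ∪ z)) (by
    intro s hs hd
    obtain ⟨hsz, hs⟩ := (eq_empty_or_mem_link_iff hz s).1 hs
    rw [← boundarySum_union hsz hc0, hc _ hs, mul_zero]
    rw [dim_union hsz]
    omega)
  -- The passage to the link is undone: the signs are their own inverses, and the cochain is
  -- extended by zero to the sets that do not contain `z`.
  let b' : Finset V → ℤ := fun x => if z ⊆ x then linkSign z (x \ z) * b (x \ z) else 0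
  have hb' : ∀ x, ¬z ⊆ x → b' x = 0 := fun x hx => if_neg hx
  refine ⟨b', hb', fun x hx hd => ?_⟩
  by_cases hzx : z ⊆ x
  · obtain ⟨s, hsz, rfl⟩ : ∃ s, Disjoint s z ∧ x = s ∪ z :=
      ⟨x \ z, Finset.sdiff_disjoint, (Finset.sdiff_union_of_subset hzx).symm⟩
    have h1 := hb s ((eq_empty_or_mem_link_iff hz s).2 ⟨hsz, hx⟩) (by
      rw [dim_union hsz] at hd
      omega)
    have h2 : boundarySum b s = linkSign z s * boundarySum b' (s ∪ z) := by
      rw [boundarySum_union hsz hb']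
      refine Finset.sum_congr rfl fun v hv => ?_
      have h3 : (s.erase v ∪ z) \ z = s.erase v :=
        Finset.union_sdiff_cancel_right (Finset.disjoint_of_subset_left (Finset.erase_subset _ _) hsz)
      simp only [b', if_pos Finset.subset_union_right, h3]
      rw [← mul_assoc, linkSign_mul_self, one_mul]
    rw [h2] at h1
    calc c (s ∪ z) = linkSign z s * (linkSign z s * c (s ∪ z)) := by
          rw [← mul_assoc, linkSign_mul_self, one_mul]
      _ = _ := by rw [h1, ← mul_assoc, linkSign_mul_self, one_mul]
  · rw [hc0 x hzx, boundarySum, Finset.sum_eq_zero]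
    intro v _
    rw [hb' _ fun h' => hzx (h'.trans (Finset.erase_subset _ _)), smul_zero]

end Cochains

/-! ### The modules `C_i` and their morphisms to `P_z` -/

section FaceChains

variable {V : Type u} (K : PreAbstractSimplicialComplex V)

/-- The module `y ↦` chains of dimension `i` on the simplex `y`. -/
def faceChains (i : ℤ) : CMod ℤ K.faces where
  obj y := ModuleCat.of ℤ (simplexChains i y.1)
  map f := ModuleCat.ofHom (Submodule.inclusion (simplexChains_mono i (leOfHom f)))

variable {K}

/-- The simplex `x` as a chain on `x`. -/
def fundamentalChain {i : ℤ} (x : K.faces) (hx : dim x.1 = i) : (faceChains K i).obj x :=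
  (⟨Finsupp.single x.1 1, single_mem_simplexChains (K.isRelLowerSet_faces x.2).1
    (Finset.Subset.refl _) hx⟩ : simplexChains i x.1)

lemma simplexChains_hom_ext {i : ℤ} {y : Finset V} {M : Type*} [AddCommGroup M] [Module ℤ M]
    {f g : simplexChains i y →ₗ[ℤ] M}
    (h : ∀ (x : Finset V) (hx : x.Nonempty) (hxy : x ⊆ y) (hi : dim x = i),
      f ⟨Finsupp.single x 1, single_mem_simplexChains hx hxy hi⟩ =
        g ⟨Finsupp.single x 1, single_mem_simplexChains hx hxy hi⟩) : f = g := by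
  let e := Finsupp.supportedEquivFinsupp (M := ℤ) (R := ℤ)
    {x : Finset V | x.Nonempty ∧ x ⊆ y ∧ dim x = i}
  have he : f ∘ₗ e.symm.toLinearMap = g ∘ₗ e.symm.toLinearMap := by
    refine Finsupp.lhom_ext' fun x => LinearMap.ext_ring ?_
    have hx : e.symm (Finsupp.single x 1) =
        ⟨Finsupp.single x.1 1, single_mem_simplexChains x.2.1 x.2.2.1 x.2.2.2⟩ := by
      exact Subtype.ext (Finsupp.supportedEquivFinsupp_symm_single _ x 1)
    change f (e.symm (Finsupp.single x 1)) = g (e.symm (Finsupp.single x 1))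
    rw [hx]
    exact h x.1 x.2.1 x.2.2.1 x.2.2.2
  refine LinearMap.ext fun c => ?_
  have := congrArg (fun t => t (e c)) he
  have hc : e.symm (e c) = c := e.symm_apply_apply c
  exact (congrArg f hc).symm.trans (this.trans (congrArg g hc))

/-- A simplex `x ⊆ y`, seen as a chain on `y`, is the image of the fundamental chain of `x` under `x
⟶ y`, so the fundamental chains generate. -/
lemma faceChains_hom_ext {i : ℤ} {G : CMod ℤ K.faces} {φ ψ : faceChains K i ⟶ G}
    (h : ∀ (x : K.faces) (hx : dim x.1 = i),
      (φ.app x).hom (fundamentalChain x hx) = (ψ.app x).hom (fundamentalChain x hx)) :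
    φ = ψ := by
  ext y : 2
  refine ModuleCat.hom_ext (simplexChains_hom_ext fun x hx hxy hi => ?_)
  let x' : K.faces := ⟨x, (K.isRelLowerSet_faces y.2).2 hxy hx⟩
  let f : x' ⟶ y := homOfLE hxy
  have h2 : ∀ χ : faceChains K i ⟶ G,
      (χ.app y).hom (⟨Finsupp.single x 1, single_mem_simplexChains hx hxy hi⟩ :
        simplexChains i y.1) = (G.map f).hom ((χ.app x').hom (fundamentalChain x' hi)) := fun χ =>
    congrArg (fun t => t.hom (fundamentalChain x' hi)) (χ.naturality f)
  exact (h2 φ).trans ((congrArg (G.map f).hom (h x' hi)).trans (h2 ψ).symm)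

/-- The sum of the coefficients of an element of `P_z(y)`. -/
def coeffSum (z y : K.faces) : ((standardProjective ℤ K.faces).obj (op z)).obj y →ₗ[ℤ] ℤ :=
  (Finsupp.linearCombination ℤ (fun _ => (1 : ℤ)) : ((z ⟶ y) →₀ ℤ) →ₗ[ℤ] ℤ)

lemma coeffSum_map (z : K.faces) {y y' : K.faces} (f : y ⟶ y')
    (p : ((standardProjective ℤ K.faces).obj (op z)).obj y) :
    coeffSum z y' ((((standardProjective ℤ K.faces).obj (op z)).map f).hom p) =
      coeffSum z y p :=
  Finsupp.linearCombination_mapDomain ℤ (fun h : z ⟶ y => h ≫ f) (show (z ⟶ y) →₀ ℤ from p)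

lemma coeffSum_eq_zero {z y : K.faces} (h : ¬z.1 ⊆ y.1)
    (p : ((standardProjective ℤ K.faces).obj (op z)).obj y) : coeffSum z y p = 0 := by
  have : IsEmpty (z ⟶ y) := ⟨fun f => h (leOfHom f)⟩
  have hp : (show (z ⟶ y) →₀ ℤ from p) = 0 := Subsingleton.elim _ _
  exact (congrArg (coeffSum z y) hp).trans (map_zero _)

/-- A poset has at most one morphism `z ⟶ y`, so `P_z(y)` is `ℤ` or `0`, and equalities in it can be
checked on integers. -/
lemma coeffSum_injective (z y : K.faces) : Function.Injective (coeffSum z y) := by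
  intro (p : (z ⟶ y) →₀ ℤ) (q : (z ⟶ y) →₀ ℤ) h
  refine Finsupp.ext fun f => ?_
  have key : ∀ p : (z ⟶ y) →₀ ℤ, coeffSum z y p = p f := by
    intro p
    have h1 : coeffSum z y = (Finsupp.lapply f : ((z ⟶ y) →₀ ℤ) →ₗ[ℤ] ℤ) := by
      refine Finsupp.lhom_ext' fun g => LinearMap.ext_ring ?_
      obtain rfl : g = f := Subsingleton.elim (α := z ⟶ y) g f
      refine (Finsupp.linearCombination_single ℤ _ _).trans ?_
      simp
    exact congrArg (fun t => t p) h1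
  rw [← key, ← key, h]

lemma linearCombination_eq_zero_of_mem {i : ℤ} {z y : Finset V} {b : Finset V → ℤ}
    (hb : ∀ x, ¬z ⊆ x → b x = 0) (hzy : ¬z ⊆ y) {c : Finset V →₀ ℤ}
    (hc : c ∈ simplexChains i y) : Finsupp.linearCombination ℤ b c = 0 := by
  refine simplexChains_induction (g := 0) (fun x _ hxy _ => ?_) hc
  rw [Finsupp.linearCombination_single, hb _ fun h => hzy (h.trans hxy), smul_zero,
    LinearMap.zero_apply]

open Classical in
/-- The value at `y` of the morphism to `P_z` given by a function on the simplices that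
contain `z`. -/
def cochainHomApp (i : ℤ) (z : K.faces) (b : Finset V → ℤ) (y : K.faces) :
    simplexChains i y.1 →ₗ[ℤ] ((standardProjective ℤ K.faces).obj (op z)).obj y :=
  (if h : z ≤ y then Finsupp.lsingle (homOfLE h) else 0 : ℤ →ₗ[ℤ] ((z ⟶ y) →₀ ℤ)) ∘ₗ
    Finsupp.linearCombination ℤ b ∘ₗ (simplexChains i y.1).subtype

lemma coeffSum_cochainHomApp {i : ℤ} {z : K.faces} {b : Finset V → ℤ}
    (hb : ∀ x, ¬z.1 ⊆ x → b x = 0) (y : K.faces) (c : simplexChains i y.1) :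
    coeffSum z y (cochainHomApp i z b y c) = Finsupp.linearCombination ℤ b c.1 := by
  by_cases h : z ≤ y
  · rw [cochainHomApp, dif_pos h]
    refine (Finsupp.linearCombination_single ℤ _ _).trans ?_
    simp
  · rw [linearCombination_eq_zero_of_mem hb h c.2, coeffSum_eq_zero h]

/-- The morphism to `P_z` given by a function on the simplices that contain `z`. -/
def cochainHom (i : ℤ) {z : K.faces} {b : Finset V → ℤ} (hb : ∀ x, ¬z.1 ⊆ x → b x = 0) :
    faceChains K i ⟶ (standardProjective ℤ K.faces).obj (op z) where
  app y := ModuleCat.ofHom (cochainHomApp i z b y)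
  naturality y y' f := by
    refine ModuleCat.hom_ext (LinearMap.ext fun (c : simplexChains i y.1) =>
      coeffSum_injective z y' ?_)
    refine (coeffSum_cochainHomApp hb y' ⟨c.1, _⟩).trans ?_
    exact ((coeffSum_map z f _).trans (coeffSum_cochainHomApp hb y c)).symm

open Classical in
/-- The function on simplices that corresponds to a morphism to `P_z`. -/
def cochainOf {i : ℤ} {z : K.faces}
    (φ : faceChains K i ⟶ (standardProjective ℤ K.faces).obj (op z)) (x : Finset V) : ℤ :=
  if h : ∃ _ : x ∈ K.faces, dim x = i then
    coeffSum z ⟨x, h.1⟩ ((φ.app ⟨x, h.1⟩).hom (fundamentalChain ⟨x, h.1⟩ h.2)) else 0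

lemma cochainOf_apply {i : ℤ} {z : K.faces}
    (φ : faceChains K i ⟶ (standardProjective ℤ K.faces).obj (op z)) (x : K.faces)
    (hx : dim x.1 = i) :
    cochainOf φ x.1 = coeffSum z x ((φ.app x).hom (fundamentalChain x hx)) :=
  dif_pos ⟨x.2, hx⟩

lemma cochainOf_eq_zero {i : ℤ} {z : K.faces}
    (φ : faceChains K i ⟶ (standardProjective ℤ K.faces).obj (op z)) (x : Finset V)
    (hx : ¬z.1 ⊆ x) : cochainOf φ x = 0 := by
  rw [cochainOf]
  split_ifs with h
  · exact coeffSum_eq_zero (y := ⟨x, h.1⟩) hx _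
  · rfl

lemma cochainHom_ext {i : ℤ} {z : K.faces}
    {φ ψ : faceChains K i ⟶ (standardProjective ℤ K.faces).obj (op z)}
    (h : ∀ x ∈ K.faces, dim x = i → cochainOf φ x = cochainOf ψ x) : φ = ψ := by
  refine faceChains_hom_ext fun x hx => coeffSum_injective z x ?_
  rw [← cochainOf_apply φ x hx, ← cochainOf_apply ψ x hx, h x.1 x.2 hx]

lemma cochainOf_cochainHom {i : ℤ} {z : K.faces} {b : Finset V → ℤ}
    (hb : ∀ x, ¬z.1 ⊆ x → b x = 0) {x : Finset V} (hx : x ∈ K.faces) (hi : dim x = i) :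
    cochainOf (cochainHom i hb) x = b x := by
  rw [cochainOf_apply (cochainHom i hb) ⟨x, hx⟩ hi]
  refine (coeffSum_cochainHomApp hb ⟨x, hx⟩ _).trans ?_
  refine (Finsupp.linearCombination_single ℤ _ _).trans ?_
  simp

/-- Together with `cochainOf_cochainHom` this identifies `Hom(C_i, P_z)` with the functions on the
`i`-simplices that contain `z`. -/
lemma cochainHom_cochainOf {i : ℤ} {z : K.faces}
    (φ : faceChains K i ⟶ (standardProjective ℤ K.faces).obj (op z)) :
    cochainHom i (cochainOf_eq_zero φ) = φ :=
  cochainHom_ext fun _ hx hi => cochainOf_cochainHom _ hx hi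

lemma coeffSum_app {i : ℤ} {z : K.faces}
    (φ : faceChains K i ⟶ (standardProjective ℤ K.faces).obj (op z)) (y : K.faces)
    (c : simplexChains i y.1) :
    coeffSum z y ((φ.app y).hom c) = Finsupp.linearCombination ℤ (cochainOf φ) c.1 := by
  conv_lhs => rw [← cochainHom_cochainOf φ]
  exact coeffSum_cochainHomApp (cochainOf_eq_zero φ) y c

open Classical in
lemma indicator_eq_zero (z : Finset V) (x : Finset V) (h : ¬z ⊆ x) :
    (if x = z then 1 else 0 : ℤ) = 0 :=
  if_neg fun he => h (by rw [he])

open Classical in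
/-- The dual basis of the module of chains of dimension `i` given by the simplices of
dimension `i`. -/
def faceChainsDualBasis (hK : K.faces.Finite) (i : ℤ) : DualBasis (faceChains K i) :=
  letI : Finite K.faces := hK.to_subtype
  letI : Fintype {x : K.faces // dim x.1 = i} := Fintype.ofFinite _
  { ι := {x : K.faces // dim x.1 = i}
    ob := fun x => x.1
    elt := fun x => fundamentalChain x.1 x.2
    coord := fun x => cochainHom i (indicator_eq_zero x.1.1)
    total := by
      refine faceChains_hom_ext fun x hx => ?_
      rw [NatTrans.app_sum, ModuleCat.hom_sum, LinearMap.sum_apply,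
        Finset.sum_eq_single_of_mem ⟨x, hx⟩ (Finset.mem_univ _)]
      · have h1 : ((cochainHom i (indicator_eq_zero x.1)).app x).hom (fundamentalChain x hx) =
            (Finsupp.single (𝟙 x) (1 : ℤ) : (x ⟶ x) →₀ ℤ) := by
          refine coeffSum_injective x x ?_
          rw [← cochainOf_apply _ x hx, cochainOf_cochainHom _ x.2 hx, if_pos rfl]
          refine Eq.trans ?_ (Finsupp.linearCombination_single ℤ _ _).symm
          simp
        exact (congrArg ((ofElement (fundamentalChain x hx)).app x).hom h1).trans
          (ofElement_apply_id _)
      · rintro ⟨y, hy⟩ _ hne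
        have h1 : ((cochainHom i (indicator_eq_zero y.1)).app x).hom (fundamentalChain x hx) =
            0 := by
          refine coeffSum_injective y x ?_
          rw [← cochainOf_apply _ x hx, cochainOf_cochainHom _ x.2 hx, if_neg, map_zero]
          exact fun h => hne (Subtype.ext (Subtype.ext h.symm))
        exact (congrArg ((ofElement (fundamentalChain y hy)).app x).hom h1).trans (map_zero _) }

lemma isZero_faceChains {i : ℤ} (h : ∀ x ∈ K.faces, dim x ≠ i) : IsZero (faceChains K i) := by
  rw [IsZero.iff_id_eq_zero]
  exact faceChains_hom_ext fun x hx => absurd hx (h x.1 x.2)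

lemma isZero_faceChains_of_neg {i : ℤ} (hi : i < 0) : IsZero (faceChains K i) :=
  isZero_faceChains fun _ hx h => by
    have := dim_nonneg (K.isRelLowerSet_faces hx).1
    omega

end FaceChains

/-! ### The coboundary on `Hom(C, P_z)` and the bound on the dimension -/

section Boundary

variable {V : Type u} [LinearOrder V] (K : PreAbstractSimplicialComplex V)

/-- The boundary as a morphism of modules. -/
def boundaryHom {i j : ℤ} (h : j + 1 = i) : faceChains K i ⟶ faceChains K j where
  app y := ModuleCat.ofHom (boundary.restrict (boundary_mem h (y := y.1)))

lemma boundaryHom_comp {i j l : ℤ} (h : j + 1 = i) (h' : l + 1 = j) :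
    boundaryHom K h ≫ boundaryHom K h' = 0 := by
  ext y : 2
  exact ModuleCat.hom_ext (LinearMap.ext fun c : simplexChains i y.1 =>
    Subtype.ext (boundary_boundary c.1))

/-- The augmentation of the chains of dimension zero. -/
def augmentation : faceChains K 0 ⟶ constMod ℤ K.faces where
  app y := ModuleCat.ofHom (ULift.moduleEquiv.symm.toLinearMap ∘ₗ
    Finsupp.linearCombination ℤ (fun _ => (1 : ℤ)) ∘ₗ (simplexChains 0 y.1).subtype)

variable {K}

/-- `boundary` drops the empty face and `boundarySum` keeps it, but `b` vanishes at `∅` because `z`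
is not empty. -/
lemma linearCombination_boundary_single {z : Finset V} (hz : z.Nonempty) {b : Finset V → ℤ}
    (hb : ∀ x, ¬z ⊆ x → b x = 0) (x : Finset V) :
    Finsupp.linearCombination ℤ b (boundary (Finsupp.single x 1)) = boundarySum b x := by
  rw [boundary_single, map_boundarySum]
  refine Finset.sum_congr rfl fun v _ => congrArg _ ?_
  beta_reduce
  split_ifs with h
  · rw [h, map_zero, hb]
    exact fun h' => hz.ne_empty (Finset.subset_empty.1 h')
  · simp

lemma cochainOf_boundaryHom_comp {i j : ℤ} (h : j + 1 = i) {z : K.faces}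
    (φ : faceChains K j ⟶ (standardProjective ℤ K.faces).obj (op z)) {x : Finset V}
    (hx : x ∈ K.faces) (hi : dim x = i) :
    cochainOf (boundaryHom K h ≫ φ) x = boundarySum (cochainOf φ) x := by
  rw [cochainOf_apply (boundaryHom K h ≫ φ) ⟨x, hx⟩ hi,
    ← linearCombination_boundary_single (K.isRelLowerSet_faces z.2).1 (cochainOf_eq_zero φ)]
  exact coeffSum_app φ ⟨x, hx⟩ _

/-- Exactness of `D(C)(z)` in degree `i`: under `cochainOf`, composition with the boundary becomes
the coboundary of cochains on the simplices containing `z`. -/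
lemma exists_boundaryHom_comp_eq {i j l : ℤ} (h : i + 1 = l) (h' : j + 1 = i) {z : K.faces}
    (hz : IsZero ((augCochainComplex (link K z.1)).homology (i - dim z.1 - 1)))
    (φ : faceChains K i ⟶ (standardProjective ℤ K.faces).obj (op z))
    (hφ : boundaryHom K h ≫ φ = 0) :
    ∃ ψ : faceChains K j ⟶ (standardProjective ℤ K.faces).obj (op z),
      boundaryHom K h' ≫ ψ = φ := by
  obtain ⟨b, hb, hb'⟩ := exists_eq_boundarySum_of_link z.2 hz (cochainOf φ)
    (cochainOf_eq_zero φ) (fun x hx hd => by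
      rw [← cochainOf_boundaryHom_comp h φ hx (by omega), hφ,
        cochainOf_apply _ ⟨x, hx⟩ (hd.trans h)]
      exact map_zero _)
  refine ⟨cochainHom j hb, cochainHom_ext fun x hx hi => ?_⟩
  rw [cochainOf_boundaryHom_comp h' _ hx hi, hb' x hx hi]
  refine Finset.sum_congr rfl fun v hv => congrArg _ ?_
  -- `cochainHom` recovers `b` only on simplices of `K`, so the empty face, where both functions
  -- vanish, is treated apart.
  rcases (x.erase v).eq_empty_or_nonempty with he | he
  · have hne : ¬z.1 ⊆ x.erase v := fun h' =>
      (K.isRelLowerSet_faces z.2).1.ne_empty (Finset.subset_empty.1 (he ▸ h'))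
    rw [cochainOf_eq_zero _ _ hne, hb _ hne]
  · refine cochainOf_cochainHom _ ((K.isRelLowerSet_faces hx).2 (Finset.erase_subset _ _) he) ?_
    have := dim_erase hv
    omega

/-- If the reduced cohomology of the links vanishes in the given degrees, the dimension of the
complex is at most `n`. -/
lemma dim_le_of_link {n : ℤ} (hK : K.faces.Finite)
    (h : ∀ x : K.faces, ∀ i : ℤ, i ≠ n - dim x.1 - 1 →
      IsZero ((augCochainComplex (link K x.1)).homology i))
    {x : Finset V} (hx : x ∈ K.faces) : dim x ≤ n := by
  obtain ⟨y, hxy, hy⟩ := hK.exists_le_maximal hx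
  have hcard : dim x ≤ dim y := by
    have := Finset.card_le_card hxy
    simp only [dim]
    omega
  refine hcard.trans (le_of_eq ?_)
  by_contra hne
  classical
  -- By maximality of `y` its indicator is a cocycle; it corresponds to the class in degree `-1` of
  -- the empty link. If `dim y ≠ n`, it is the coboundary of a cochain supported on sets containing
  -- `y`. No proper face of `y` is such a set, so the value at `y` would be `0`.
  obtain ⟨b, hb, hb'⟩ := exists_eq_boundarySum_of_link hy.1 (h ⟨y, hy.1⟩ _ (by
      dsimp only
      omega : dim y - dim y - 1 ≠ _)) _ (indicator_eq_zero y) (by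
      intro w hw hd
      refine Finset.sum_eq_zero fun v hv => ?_
      beta_reduce
      rw [if_neg, smul_zero]
      intro he
      have h1 : y ⊆ w := he ▸ Finset.erase_subset v w
      have h2 : w ⊆ y := hy.2 hw h1
      rw [Finset.Subset.antisymm h2 h1] at hd
      omega)
  have h1 := hb' y hy.1 rfl
  rw [if_pos rfl, boundarySum, Finset.sum_eq_zero] at h1
  · exact one_ne_zero h1
  · intro v hv
    rw [hb _ fun h' => Finset.notMem_erase v y (h' hv), smul_zero]

end Boundary

/-! ### Resolutions indexed by the integers and derived functors -/

section NonnegPart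

variable {Y : Type*} [Category* Y] [Preadditive Y]

/-- The part in nonnegative degrees of a chain complex indexed by the integers. -/
def nonnegPart (Y : Type*) [Category* Y] [Preadditive Y] :
    ChainComplex Y ℤ ⥤ ChainComplex Y ℕ where
  obj M :=
    { X := fun i => M.X i
      d := fun i j => M.d i j
      shape := fun i j h => M.shape _ _ fun h' => h (by
        change (j : ℤ) + 1 = i at h'
        change j + 1 = i
        omega)
      d_comp_d' := fun i j l _ _ => M.d_comp_d _ _ _ }
  map φ :=
    { f := fun i => φ.f i
      comm' := fun i j _ => φ.comm _ _ }

/-- The comparison of short complexes for the nonnegative part of a chain complex, in degree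
zero. -/
def nonnegPartShortZero :
    HomologicalComplex.shortComplexFunctor' Y (ComplexShape.down ℤ) ((1 : ℕ) : ℤ) ((0 : ℕ) : ℤ)
      (-1) ⟶ nonnegPart Y ⋙ HomologicalComplex.shortComplexFunctor' Y (ComplexShape.down ℕ) 1 0 0
    where
  app M :=
    { τ₁ := 𝟙 _
      τ₂ := 𝟙 _
      τ₃ := 0
      comm₁₂ := (Category.id_comp _).trans (Category.comp_id _).symm
      comm₂₃ := by
        refine (Category.id_comp _).trans (Eq.trans ?_ comp_zero.symm)
        exact M.shape _ _ (by simp) }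
  naturality M N φ := by
    ext
    · exact (Category.comp_id _).trans (Category.id_comp _).symm
    · exact (Category.comp_id _).trans (Category.id_comp _).symm
    · exact comp_zero.trans zero_comp.symm

variable [CategoryWithHomology Y]

/-- The nonnegative part of a chain complex that vanishes in negative degrees has the same
homology; here the homology is computed by a given short complex. -/
lemma exists_nonnegPart_homologyIso (i : ℕ) {a c : ℤ} (ha : (i : ℤ) + 1 = a)
    (hc : c + 1 = (i : ℤ)) :
    ∃ ν : HomologicalComplex.shortComplexFunctor' Y (ComplexShape.down ℤ) a i c ⋙
        ShortComplex.homologyFunctor Y ⟶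
          nonnegPart Y ⋙ HomologicalComplex.homologyFunctor Y (ComplexShape.down ℕ) i,
      ∀ M : ChainComplex Y ℤ, (∀ j < 0, IsZero (M.X j)) → IsIso (ν.app M) := by
  subst ha
  rcases i with _ | i
  · obtain rfl : c = -1 := by
      push_cast at hc
      omega
    -- In degree zero the short complex indexed by `ℕ` ends with the zero map from `X_0` to itself,
    -- the one indexed by `ℤ` with the map to `X_{-1}`. Once `X_{-1} = 0` the homologies agree.
    refine ⟨Functor.whiskerRight nonnegPartShortZero (ShortComplex.homologyFunctor Y) ≫
      Functor.whiskerLeft (nonnegPart Y) (HomologicalComplex.homologyFunctorIso' Y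
        (ComplexShape.down ℕ) 1 0 0 (by simp) (by simp)).inv, fun M hM => ?_⟩
    have h0 : IsIso ((Functor.whiskerRight nonnegPartShortZero
        (ShortComplex.homologyFunctor Y)).app M) := by
      have h1 : Epi (nonnegPartShortZero.app M).τ₁ := inferInstanceAs (Epi (𝟙 _))
      have h2 : IsIso (nonnegPartShortZero.app M).τ₂ := inferInstanceAs (IsIso (𝟙 _))
      have h3 : Mono (nonnegPartShortZero.app M).τ₃ :=
        ⟨fun _ _ _ => (hM (-1) (by norm_num)).eq_of_tgt _ _⟩
      have := ShortComplex.quasiIso_of_epi_of_isIso_of_mono (nonnegPartShortZero.app M)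
      exact this.isIso'
    rw [NatTrans.comp_app]
    infer_instance
  · obtain rfl : c = (i : ℤ) := by
      push_cast at hc
      omega
    let E := HomologicalComplex.homologyFunctorIso' Y (ComplexShape.down ℕ) (i + 2) (i + 1) i
      (by simp) (by simp)
    exact ⟨Functor.whiskerLeft (nonnegPart Y) E.inv, fun M _ =>
      inferInstanceAs (IsIso (E.inv.app ((nonnegPart Y).obj M)))⟩

end NonnegPart

section Resolution

lemma iso_trans_symm_naturality {D : Type*} [Category* D] {M M' N N' L L' : D} {h : M ⟶ M'}
    {m : N ⟶ N'} {l : L ⟶ L'} (e : M ≅ N) (e' : M' ≅ N') (f : L ≅ N) (f' : L' ≅ N')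
    (h₁ : h ≫ e'.hom = e.hom ≫ m) (h₂ : l = f.hom ≫ m ≫ f'.inv) :
    h ≫ (e' ≪≫ f'.symm).hom = (e ≪≫ f.symm).hom ≫ l := by
  subst h₂
  simp [reassoc_of% h₁]

variable {A : Type*} [Category* A] [Abelian A]

/-- A projective resolution from an exact augmented complex of projectives. -/
def projectiveResolutionOfExact (P : ChainComplex A ℕ) (hP : ∀ i, Projective (P.X i)) {X : A}
    (p : P.X 0 ⟶ X) (hp : P.d 1 0 ≫ p = 0) (hep : Epi p) (h0 : (ShortComplex.mk _ _ hp).Exact)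
    (h : ∀ i, P.ExactAt (i + 1)) : ProjectiveResolution X where
  complex := P
  projective := hP
  π := (ChainComplex.toSingle₀Equiv _ _).symm ⟨p, hp⟩
  quasiIso := ⟨fun n => by
    cases n
    · rw [ChainComplex.quasiIsoAt₀_iff, ShortComplex.quasiIso_iff_of_zeros']
      · refine (ShortComplex.exact_and_epi_g_iff_of_iso ?_).2 ⟨h0, hep⟩
        exact ShortComplex.isoMk (Iso.refl _) (Iso.refl _) (Iso.refl _)
          ((Category.id_comp _).trans (Category.comp_id _).symm)
          ((Category.id_comp _).trans
            ((ChainComplex.toSingle₀Equiv_symm_apply_f_zero p hp).symm.trans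
              (Category.comp_id _).symm))
      all_goals first | rfl | exact P.shape _ _ (by simp)
    · rw [quasiIsoAt_iff_exactAt']
      · exact h _
      · apply ChainComplex.exactAt_succ_single_obj⟩

/-- A projective resolution given by a chain complex indexed by the integers that vanishes in
negative degrees. -/
structure IntResolution (X : A) where
  /-- the complex -/
  complex : ChainComplex A ℤ
  isZero : ∀ j < 0, IsZero (complex.X j)
  projective : ∀ j, Projective (complex.X j)
  /-- the augmentation -/
  π : complex.X 0 ⟶ X
  w : complex.d 1 0 ≫ π = 0
  epi : Epi π
  exact_zero : (ShortComplex.mk _ _ w).Exact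
  exact_pos : ∀ a b c : ℤ, b + 1 = a → c + 1 = b → 0 < b → (complex.sc' a b c).Exact

namespace IntResolution

variable {X : A} (R : IntResolution X)

/-- The underlying projective resolution. -/
def toProjectiveResolution : ProjectiveResolution X :=
  projectiveResolutionOfExact ((nonnegPart A).obj R.complex) (fun i => R.projective i) R.π
    R.w R.epi R.exact_zero fun i => by
      rw [HomologicalComplex.exactAt_iff' _ (i + 2) (i + 1) i (by simp) (by simp)]
      exact R.exact_pos _ _ _ (by push_cast; ring) (by push_cast; ring) (by positivity)

/-- The short complex that computes the left derived functors of `F`. -/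
def short {D : Type*} [Category* D] [Abelian D] (F : A ⥤ D) [F.Additive] (a b c : ℤ) :
    ShortComplex D :=
  ((F.mapHomologicalComplex (ComplexShape.down ℤ)).obj R.complex).sc' a b c

/-- The morphism of short complexes induced by a natural transformation. -/
def shortMap {D : Type*} [Category* D] [Abelian D] {F G : A ⥤ D} [F.Additive] [G.Additive]
    (α : F ⟶ G) (a b c : ℤ) : R.short F a b c ⟶ R.short G a b c :=
  (HomologicalComplex.shortComplexFunctor' D (ComplexShape.down ℤ) a b c).map
    ((NatTrans.mapHomologicalComplex α (ComplexShape.down ℤ)).app R.complex)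

/-- A single family `e` is compatible with all natural transformations; this makes the final
isomorphism natural in the coefficients. Explicit neighbours `a`, `c` of the degree allow the
reflection `j ↦ n - j`. -/
lemma exists_leftDerivedIso [HasProjectiveResolutions A] {D : Type*} [Category* D] [Abelian D]
    (i : ℕ) {a c : ℤ}
    (ha : (i : ℤ) + 1 = a) (hc : c + 1 = (i : ℤ)) :
    ∃ e : ∀ (F : A ⥤ D) [F.Additive], (R.short F a i c).homology ≅ (F.leftDerived i).obj X,
      ∀ (F G : A ⥤ D) [F.Additive] [G.Additive] (α : F ⟶ G),
        ShortComplex.homologyMap (R.shortMap α a i c) ≫ (e G).hom =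
          (e F).hom ≫ (NatTrans.leftDerived α i).app X := by
  obtain ⟨ν, hν⟩ := exists_nonnegPart_homologyIso (Y := D) i ha hc
  have hF : ∀ (F : A ⥤ D) [F.Additive],
      IsIso (ν.app ((F.mapHomologicalComplex (ComplexShape.down ℤ)).obj R.complex)) :=
    fun F _ => hν _ fun j hj => F.map_isZero (R.isZero j hj)
  let e' : ∀ (F : A ⥤ D) [F.Additive], (R.short F a i c).homology ≅
      (HomologicalComplex.homologyFunctor D (ComplexShape.down ℕ) i).obj
        ((F.mapHomologicalComplex (ComplexShape.down ℕ)).obj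
          R.toProjectiveResolution.complex) := fun F _ =>
    @asIso _ _ _ _ (ν.app ((F.mapHomologicalComplex (ComplexShape.down ℤ)).obj R.complex)) (hF F)
  refine ⟨fun F _ => e' F ≪≫ (R.toProjectiveResolution.isoLeftDerivedObj F i).symm,
    fun F G _ _ α => iso_trans_symm_naturality (e' F) (e' G)
      (R.toProjectiveResolution.isoLeftDerivedObj F i)
      (R.toProjectiveResolution.isoLeftDerivedObj G i) ?_
      (ProjectiveResolution.leftDerived_app_eq α R.toProjectiveResolution i)⟩
  exact ν.naturality ((NatTrans.mapHomologicalComplex α (ComplexShape.down ℤ)).app R.complex)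

end IntResolution

end Resolution

section Pointwise

variable {k : Type} [CommRing k] {C : Type u} [SmallCategory C]

/-- Evaluation at an object commutes with homology, and a functor is zero once all its values are.
-/
lemma exact_of_pointwise (S : ShortComplex (CMod k C))
    (h : ∀ (y : C) (c : S.X₂.obj y), (S.g.app y).hom c = 0 → ∃ b, (S.f.app y).hom b = c) :
    S.Exact := by
  rw [ShortComplex.exact_iff_isZero_homology, Functor.isZero_iff]
  intro y
  refine IsZero.of_iso ?_ (S.mapHomologyIso ((evaluation C (ModuleCat.{u} k)).obj y)).symm
  rw [← ShortComplex.exact_iff_isZero_homology, ShortComplex.moduleCat_exact_iff]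
  exact h y

lemma epi_of_pointwise {F G : CMod k C} (φ : F ⟶ G)
    (h : ∀ y, Function.Surjective (φ.app y).hom) : Epi φ := by
  rw [NatTrans.epi_iff_epi_app]
  exact fun y => (ModuleCat.epi_iff_surjective _).2 (h y)

end Pointwise

/-! ### The resolution of the constant functor -/

section FaceResolution

variable {V : Type u} [LinearOrder V] (K : PreAbstractSimplicialComplex V)

/-- The complex of the modules of chains of the simplices. -/
def faceComplex : ChainComplex (CMod ℤ K.faces) ℤ where
  X i := faceChains K i
  d i j := if h : j + 1 = i then boundaryHom K h else 0
  shape i j h := dif_neg h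
  d_comp_d' i j l hij hjl := by
    change j + 1 = i at hij
    change l + 1 = j at hjl
    rw [dif_pos hij, dif_pos hjl, boundaryHom_comp]

lemma faceComplex_d {i j : ℤ} (h : j + 1 = i) : (faceComplex K).d i j = boundaryHom K h :=
  dif_pos h

variable {K}

/-- The augmentation is the coefficient of the empty simplex in the augmented boundary. -/
lemma augmentation_apply_eq_zero_iff {y : K.faces} (c : simplexChains 0 y.1) :
    ((augmentation K).app y).hom c = 0 ↔ augBoundary c.1 = 0 := by
  rw [augBoundary_eq_single_empty c.2, Finsupp.single_eq_zero]
  exact ULift.moduleEquiv.symm.map_eq_zero_iff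

lemma boundaryHom_comp_augmentation : (faceComplex K).d 1 0 ≫ augmentation K = 0 := by
  rw [faceComplex_d K (zero_add 1)]
  ext y : 2
  refine ModuleCat.hom_ext (LinearMap.ext fun c : simplexChains 1 y.1 => ?_)
  refine (augmentation_apply_eq_zero_iff (y := y) ⟨boundary c.1, boundary_mem (zero_add 1) c.2⟩).2 ?_
  change augBoundary (boundary c.1) = 0
  rw [← augBoundary_eq_boundary one_ne_zero c.2, augBoundary_augBoundary]

/-- The resolution of the constant functor `ℤ` by the chains of the simplices. -/
def faceResolution (hK : K.faces.Finite) : IntResolution (constMod ℤ K.faces) where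
  complex := faceComplex K
  isZero j hj := isZero_faceChains_of_neg hj
  projective j := (faceChainsDualBasis hK j).projective
  π := augmentation K
  w := boundaryHom_comp_augmentation
  epi := epi_of_pointwise _ fun y a => by
    obtain ⟨v, hv⟩ := (K.isRelLowerSet_faces y.2).1
    obtain ⟨a⟩ := a
    have hmem : Finsupp.single {v} 1 ∈ simplexChains 0 y.1 :=
      single_mem_simplexChains (Finset.singleton_nonempty v) (Finset.singleton_subset_iff.2 hv)
        (by simp [dim])
    refine ⟨(⟨a • Finsupp.single {v} 1, Submodule.smul_mem _ a hmem⟩ : simplexChains 0 y.1), ?_⟩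
    refine congrArg ULift.up ?_
    change Finsupp.linearCombination ℤ (fun _ => (1 : ℤ)) (a • Finsupp.single {v} 1) = a
    simp
  exact_zero := exact_of_pointwise _ fun y (c : simplexChains 0 y.1) hc => by
    obtain ⟨b, hb, hbc⟩ := exists_boundary_eq_of_augBoundary_eq_zero (zero_add 1)
      (K.isRelLowerSet_faces y.2).1 c.2 ((augmentation_apply_eq_zero_iff (y := y) c).1 hc)
    refine ⟨(⟨b, hb⟩ : simplexChains 1 y.1), ?_⟩
    change (((faceComplex K).d 1 0).app y).hom (⟨b, hb⟩ : simplexChains 1 y.1) = c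
    rw [faceComplex_d K (zero_add 1)]
    exact Subtype.ext hbc
  exact_pos a b c hab hbc hb := exact_of_pointwise _ fun y (x : simplexChains b y.1) hx => by
    change (((faceComplex K).d b c).app y).hom x = 0 at hx
    rw [faceComplex_d K hbc] at hx
    obtain ⟨t, ht, htx⟩ := exists_boundary_eq hb.ne' hab (K.isRelLowerSet_faces y.2).1 x.2
      (congrArg Subtype.val hx)
    refine ⟨(⟨t, ht⟩ : simplexChains a y.1), ?_⟩
    change (((faceComplex K).d a b).app y).hom (⟨t, ht⟩ : simplexChains a y.1) = x
    rw [faceComplex_d K hab]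
    exact Subtype.ext htx

lemma isTypeFP_constMod (hK : K.faces.Finite) : IsTypeFP (constMod ℤ K.faces) := by
  refine ⟨(faceResolution hK).toProjectiveResolution,
    fun i => (faceChainsDualBasis hK i).isFiniteType, ?_⟩
  obtain ⟨N, hN⟩ := (hK.image Finset.card).bddAbove
  refine ⟨N, fun i hi => isZero_faceChains fun x hx hd => ?_⟩
  have := hN (Set.mem_image_of_mem _ hx)
  simp only [dim] at hd
  omega

end FaceResolution

lemma isZero_const_punit {J : Type*} [Category* J] {k : Type} [CommRing k] :
    IsZero ((Functor.const J).obj (ModuleCat.of k PUnit.{u + 1})) :=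
  Functor.isZero _ fun _ => ModuleCat.isZero_of_subsingleton (ModuleCat.of k PUnit)

/-! ### The cohomology of `D(C)` -/

section DualComplex

variable {V : Type u} [LinearOrder V] {K : PreAbstractSimplicialComplex V}
  (hK : K.faces.Finite)

/-- The short complex `D(C_c) ⟶ D(C_b) ⟶ D(C_a)`. -/
def dualShort (a b c : ℤ) : ShortComplex (CMod ℤ K.facesᵒᵖ) :=
  ((faceResolution hK).short (dual ℤ K.faces).rightOp a b c).unop

/-- The derived dual of the constant functor is the cohomology of the dual of the resolution. -/
lemma nonempty_derivedDual_iso {a b c : ℤ} (ha : b + 1 = a) (hc : c + 1 = b) :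
    Nonempty (derivedDual (constMod ℤ K.faces) b ≅ (dualShort hK a b c).homology) := by
  rcases b with b | b
  · obtain ⟨e, -⟩ := (faceResolution hK).exists_leftDerivedIso (D := (CMod ℤ K.facesᵒᵖ)ᵒᵖ) b ha hc
    exact ⟨(e (dual ℤ K.faces).rightOp).unop ≪≫ (dualShort hK a b c).homologyOpIso.symm.unop⟩
  · have h1 : IsZero (derivedDual (constMod ℤ K.faces) (Int.negSucc b)) :=
      isZero_const_punit
    have h2 : IsZero (dualShort hK a (Int.negSucc b) c).X₂ :=
      ((dual ℤ K.faces).rightOp.map_isZero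
        (isZero_faceChains_of_neg (Int.negSucc_lt_zero b))).unop
    exact ⟨h1.iso ((ShortComplex.exact_iff_isZero_homology _).1 (ShortComplex.exact_of_isZero_X₂ _ h2))⟩

variable {n : ℤ} (h : ∀ x : K.faces, ∀ i : ℤ, i ≠ n - dim x.1 - 1 →
  IsZero ((augCochainComplex (link K x.1)).homology i))

include hK h

/-- At `z` the relevant degree in the link is `b - dim z - 1`, which differs from the exceptional
one because `b ≠ n`. -/
lemma dualShort_exact {a b c : ℤ} (ha : b + 1 = a) (hc : c + 1 = b) (hb : b ≠ n) :
    (dualShort hK a b c).Exact :=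
  exact_of_pointwise _ fun z (φ : faceChains K b ⟶ (standardProjective ℤ K.faces).obj z) hφ => by
    change (faceComplex K).d a b ≫ φ = 0 at hφ
    rw [faceComplex_d K ha] at hφ
    obtain ⟨ψ, hψ⟩ := exists_boundaryHom_comp_eq ha hc (h z.unop _ (by omega)) φ hφ
    refine ⟨ψ, ?_⟩
    change (faceComplex K).d b c ≫ ψ = φ
    rw [faceComplex_d K hc]
    exact hψ

lemma isZero_faceChains_of_lt {i : ℤ} (hi : n < i) : IsZero (faceChains K i) :=
  isZero_faceChains fun x hx hd => by
    have := dim_le_of_link hK h hx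
    omega

end DualComplex

/-! ### Concentration in one degree in the derived category -/

section Single

variable {B : Type*} [Category* B] [Abelian B]

/-- Such a complex lies in both halves of the t-structure at `n`, hence is a single object in degree
`n`, which its homology identifies. -/
lemma nonempty_iso_singleFunctor [HasDerivedCategory B] (L : CochainComplex B ℤ) (n : ℤ)
    (h : ∀ i, i ≠ n → L.ExactAt i) {H : B} (e : L.homology n ≅ H) :
    Nonempty (DerivedCategory.Q.obj L ≅ (DerivedCategory.singleFunctor B n).obj H) := by
  have h1 : (DerivedCategory.Q.obj L).IsGE n := by
    rw [DerivedCategory.isGE_Q_obj_iff, CochainComplex.isGE_iff]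
    exact fun i hi => h i hi.ne
  have h2 : (DerivedCategory.Q.obj L).IsLE n := by
    rw [DerivedCategory.isLE_Q_obj_iff, CochainComplex.isLE_iff]
    exact fun i hi => h i hi.ne'
  obtain ⟨M, ⟨f⟩⟩ := DerivedCategory.exists_iso_singleFunctor_obj_of_isGE_of_isLE
    (DerivedCategory.Q.obj L) n
  let g : M ≅ H := ((DerivedCategory.singleFunctorCompHomologyFunctorIso B n).app M).symm ≪≫
    (DerivedCategory.homologyFunctor B n).mapIso f.symm ≪≫
    (DerivedCategory.homologyFunctorFactors B n).app L ≪≫ e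
  exact ⟨f ≪≫ (DerivedCategory.singleFunctor B n).mapIso g⟩

end Single

section EilenbergMacLane

variable {k : Type} [CommRing k] {C : Type u} [SmallCategory C]

lemma nonempty_extend_dualComplex_homology_iso (F : CMod k C) (i : ℤ) :
    Nonempty (((dualComplex (projectiveResolution F).complex).extend
      ComplexShape.embeddingUpNat).homology i ≅ derivedDual F i) := by
  rcases i with i | i
  · exact ⟨HomologicalComplex.extendHomologyIso _ ComplexShape.embeddingUpNat (j := i) rfl ≪≫
      HomologicalComplex.homologyUnop
        (((dual k C).rightOp.mapHomologicalComplex _).obj (projectiveResolution F).complex) i ≪≫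
      ((projectiveResolution F).isoLeftDerivedObj (dual k C).rightOp i).unop⟩
  · have h1 : IsZero (derivedDual F (Int.negSucc i)) :=
      isZero_const_punit
    have h2 := (HomologicalComplex.extend_exactAt
      (dualComplex (projectiveResolution F).complex) ComplexShape.embeddingUpNat
      (Int.negSucc i) (fun j hj => by
        change (j : ℤ) = Int.negSucc i at hj
        omega)).isZero_homology
    exact ⟨h2.iso h1⟩

/-- Only homology matters, so the resolution in the definition need not be compared, as a complex,
with the chains of simplices. -/
lemma isEilenbergMacLane_of_isZero (F : CMod k C) (n : ℤ)
    (h : ∀ i, i ≠ n → IsZero (derivedDual F i)) : IsEilenbergMacLane F n := by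
  let _ : HasDerivedCategory (CMod k Cᵒᵖ) := HasDerivedCategory.standard _
  refine nonempty_iso_singleFunctor _ n (fun i hi => ?_)
    (nonempty_extend_dualComplex_homology_iso F n).some
  rw [HomologicalComplex.exactAt_iff_isZero_homology]
  exact (h i hi).of_iso (nonempty_extend_dualComplex_homology_iso F i).some

end EilenbergMacLane

/-! ### The projective resolution of `D^n(ℤ)` -/

section Cokernel

variable {B : Type*} [Category* B] [Abelian B]

/-- The projection to the homology of a short complex whose second morphism vanishes. -/
lemma exists_epi_to_homology (S : ShortComplex B) (hg : S.g = 0) {H : B} (e : H ≅ S.homology) :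
    ∃ (p : S.X₂ ⟶ H) (w : S.f ≫ p = 0), Epi p ∧ (ShortComplex.mk S.f p w).Exact := by
  -- The homology sits in the cokernel of `S.f` as the kernel of the map induced by `S.g`, so it is
  -- the whole cokernel here.
  have := S.isIso_homologyι hg
  let e' : S.opcycles ≅ H := (asIso S.homologyι).symm ≪≫ e.symm
  have w : S.f ≫ S.pOpcycles ≫ e'.hom = 0 := by
    rw [S.f_pOpcycles_assoc, zero_comp]
  refine ⟨S.pOpcycles ≫ e'.hom, w, inferInstance, ?_⟩
  have h1 : (ShortComplex.mk S.f S.pOpcycles S.f_pOpcycles).Exact :=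
    ShortComplex.exact_of_g_is_cokernel _ S.opcyclesIsCokernel
  refine ShortComplex.exact_of_iso (ShortComplex.isoMk
    (S₁ := ShortComplex.mk S.f S.pOpcycles S.f_pOpcycles)
    (S₂ := ShortComplex.mk S.f (S.pOpcycles ≫ e'.hom) w) (Iso.refl _) (Iso.refl _) e' ?_ ?_) h1
  · exact (Category.id_comp _).trans (Category.comp_id _).symm
  · exact Category.id_comp _

end Cokernel

section DualResolution

variable {V : Type u} [LinearOrder V] (K : PreAbstractSimplicialComplex V)

lemma dual_map_zero {k : Type} [CommRing k] {C : Type u} [SmallCategory C] (F G : CMod k C) :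
    (dual k C).map (0 : F ⟶ G).op = 0 :=
  congrArg Quiver.Hom.unop ((dual k C).rightOp.map_zero F G)

/-- The dual of the resolution of the constant functor, as a chain complex that starts in
degree `n`. -/
def dualFaceComplex (n : ℤ) : ChainComplex (CMod ℤ K.facesᵒᵖ) ℤ where
  X j := (dual ℤ K.faces).obj (op ((faceComplex K).X (n - j)))
  d i j := (dual ℤ K.faces).map ((faceComplex K).d (n - j) (n - i)).op
  shape i j h := by
    rw [(faceComplex K).shape, dual_map_zero]
    intro h'
    change n - i + 1 = n - j at h'
    refine h ?_
    change j + 1 = i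
    omega
  d_comp_d' i j l _ _ := by
    rw [← Functor.map_comp, ← op_comp, (faceComplex K).d_comp_d, dual_map_zero]

variable {K} (hK : K.faces.Finite) {n : ℤ} (h : ∀ x : K.faces, ∀ i : ℤ, i ≠ n - dim x.1 - 1 →
  IsZero ((augCochainComplex (link K x.1)).homology i))

include hK h

lemma exists_dualFaceComplex_augmentation :
    ∃ (p : (dualFaceComplex K n).X 0 ⟶ derivedDual (constMod ℤ K.faces) n)
      (w : (dualFaceComplex K n).d 1 0 ≫ p = 0), Epi p ∧ (ShortComplex.mk _ _ w).Exact := by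
  -- The indices are left unsimplified, as `dualFaceComplex` carries them in degrees `-1`, `0`, `1`,
  -- so that the two complexes agree by definition.
  have hd : Nonempty (derivedDual (constMod ℤ K.faces) n ≅
      (dualShort hK (n - (-1)) (n - 0) (n - 1)).homology) := by
    have := nonempty_derivedDual_iso hK (a := n - (-1)) (b := n - 0) (c := n - 1) (by ring)
      (by ring)
    rwa [show derivedDual (constMod ℤ K.faces) (n - 0) = derivedDual (constMod ℤ K.faces) n by
      rw [sub_zero]] at this
  refine exists_epi_to_homology (dualShort hK (n - (-1)) (n - 0) (n - 1)) ?_ hd.some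
  -- The outgoing map ends in `D(C_{n+1})`, which is zero by the bound on the dimension.
  exact ((dual ℤ K.faces).rightOp.map_isZero
    (isZero_faceChains_of_lt hK h (i := n - (-1)) (by omega))).unop.eq_of_tgt _ _

/-- The resolution of the dualizing module by the dual of the resolution of the constant
functor. -/
def dualResolution : IntResolution (derivedDual (constMod ℤ K.faces) n) where
  complex := dualFaceComplex K n
  isZero j hj := ((dual ℤ K.faces).rightOp.map_isZero
    (isZero_faceChains_of_lt hK h (i := n - j) (by omega))).unop
  projective j := (faceChainsDualBasis hK (n - j)).toDual.projective
  π := (exists_dualFaceComplex_augmentation hK h).choose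
  w := (exists_dualFaceComplex_augmentation hK h).choose_spec.choose
  epi := (exists_dualFaceComplex_augmentation hK h).choose_spec.choose_spec.1
  exact_zero := (exists_dualFaceComplex_augmentation hK h).choose_spec.choose_spec.2
  exact_pos a b c hab hbc hb :=
    -- The reflection exchanges the outer indices, and `b > 0` gives `n - b ≠ n`.
    dualShort_exact hK h (a := n - c) (b := n - b) (c := n - a) (by omega) (by omega) (by omega)

end DualResolution

/-! ### Comparison of `Ext` and `Tor` -/

section ExtTor

/-- The bifunctor of morphisms `G ↦ (F ↦ Hom(F, G))`. -/
abbrev homFunctor (k : Type) [CommRing k] (C : Type u) [SmallCategory C] :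
    CMod k C ⥤ (CMod k C)ᵒᵖ ⥤ ModuleCat.{u} k :=
  linearYoneda k (CMod k C)

lemma iso_trans_naturality {D : Type*} [Category* D] {M M' N N' L L' : D} {f : M ⟶ M'}
    {m : N ⟶ N'} {l : L ⟶ L'} (e₁ : M ≅ N) (e₁' : M' ≅ N') (e₂ : N ≅ L) (e₂' : N' ≅ L')
    (h₁ : f ≫ e₁'.hom = e₁.hom ≫ m) (h₂ : m ≫ e₂'.hom = e₂.hom ≫ l) :
    f ≫ (e₁' ≪≫ e₂').hom = (e₁ ≪≫ e₂).hom ≫ l := by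
  simp [reassoc_of% h₁, h₂]

variable {V : Type u} [LinearOrder V] {K : PreAbstractSimplicialComplex V}
  (hK : K.faces.Finite)

/-- The short complex `Hom(C_c, G) ⟶ Hom(C_b, G) ⟶ Hom(C_a, G)`, as a functor of `G`. -/
def homShort (a b c : ℤ) : CMod ℤ K.faces ⥤ ShortComplex (ModuleCat.{u} ℤ) where
  obj G := ((faceResolution hK).short
    ((homFunctor ℤ K.faces).obj G).rightOp a b c).unop
  map g := ShortComplex.unopMap ((faceResolution hK).shortMap
    (NatTrans.rightOp ((homFunctor ℤ K.faces).map g)) a b c)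
  map_id G := by
    ext : 1 <;> exact congr_app ((homFunctor ℤ K.faces).map_id G) _
  map_comp f g := by
    ext : 1 <;> exact congr_app ((homFunctor ℤ K.faces).map_comp f g) _

/-- The functor `G ↦ H^b(Hom(C, G))`. -/
abbrev homCohomology (a b c : ℤ) : CMod ℤ K.faces ⥤ ModuleCat.{u} ℤ :=
  homShort hK a b c ⋙ ShortComplex.homologyFunctor _

lemma isZero_homCohomology {a b c : ℤ} (hb : IsZero (faceChains K b)) :
    IsZero (homCohomology hK a b c) :=
  Functor.isZero _ fun G => (ShortComplex.exact_iff_isZero_homology _).1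
    (ShortComplex.exact_of_isZero_X₂ _
      (((homFunctor ℤ K.faces).obj G).rightOp.map_isZero hb).unop)

/-- `Ext` comes from left derived functors of `Hom(-, G)` with values in the opposite category;
`homologyOpIso` carries the homology back. -/
lemma nonempty_ext_iso {a b c : ℤ} (ha : b + 1 = a) (hc : c + 1 = b) :
    Nonempty (ext (constMod ℤ K.faces) b ≅ homCohomology hK a b c) := by
  rcases b with b | b
  · obtain ⟨e, he⟩ := (faceResolution hK).exists_leftDerivedIso (D := (ModuleCat.{u} ℤ)ᵒᵖ) b ha hc
    let Φ (G : CMod ℤ K.faces) := ((homFunctor ℤ K.faces).obj G).rightOp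
    let e₁ (G : CMod ℤ K.faces) : (ext (constMod ℤ K.faces) (Int.ofNat b)).obj G ≅
      unop ((faceResolution hK).short (Φ G) a b c).homology := (e (Φ G)).unop
    let e₂ (G : CMod ℤ K.faces) : unop ((faceResolution hK).short (Φ G) a b c).homology ≅
      ((homShort hK a b c).obj G).homology :=
        ((homShort hK a b c).obj G).homologyOpIso.symm.unop
    refine ⟨NatIso.ofComponents (fun G => e₁ G ≪≫ e₂ G) fun {G G'} g =>
      iso_trans_naturality (e₁ G) (e₁ G') (e₂ G) (e₂ G')
        (m := (ShortComplex.homologyMap ((faceResolution hK).shortMap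
          (NatTrans.rightOp ((homFunctor ℤ K.faces).map g)) a b c)).unop) ?_ ?_⟩
    · exact (congrArg Quiver.Hom.unop (he (Φ G') (Φ G)
        (NatTrans.rightOp ((homFunctor ℤ K.faces).map g)))).symm
    · exact (congrArg Quiver.Hom.unop (ShortComplex.homologyOpIso_inv_naturality
        ((homShort hK a b c).map g))).symm
  · exact ⟨isZero_const_punit.iso
      (isZero_homCohomology hK (isZero_faceChains_of_neg (Int.negSucc_lt_zero b)))⟩

variable {n : ℤ} (h : ∀ x : K.faces, ∀ i : ℤ, i ≠ n - dim x.1 - 1 →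
  IsZero ((augCochainComplex (link K x.1)).homology i))

/-- The comparison of the complexes that compute `Tor` and `Ext`. -/
def torShortIso (a b c : ℤ) (G : CMod ℤ K.faces) :
    (dualResolution hK h).short ((tensor ℤ K.faces).flip.obj G) a b c ≅
      (homShort hK (n - c) (n - b) (n - a)).obj G :=
  have e (i : ℤ) : IsIso (tensorToHom (faceChains K i) G) :=
    (faceChainsDualBasis hK i).isIso_tensorToHom G
  ShortComplex.isoMk (@asIso _ _ _ _ (tensorToHom (faceChains K (n - a)) G) (e _))
    (@asIso _ _ _ _ (tensorToHom (faceChains K (n - b)) G) (e _))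
    (@asIso _ _ _ _ (tensorToHom (faceChains K (n - c)) G) (e _))
    (tensorToHom_naturality_left _).symm (tensorToHom_naturality_left _).symm

lemma torShortIso_naturality (a b c : ℤ) {G G' : CMod ℤ K.faces} (g : G ⟶ G') :
    (dualResolution hK h).shortMap ((tensor ℤ K.faces).flip.map g) a b c ≫
        (torShortIso hK h a b c G').hom =
      (torShortIso hK h a b c G).hom ≫ (homShort hK (n - c) (n - b) (n - a)).map g := by
  ext : 1 <;> exact tensorToHom_naturality_right g

include h in
-- Tensoring the resolution `D(C_{n-j})` of `D^n(ℤ)` with `G` gives `Hom(C_{n-j}, G)`.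
lemma nonempty_tor_iso {a b c : ℤ} (ha : b + 1 = a) (hc : c + 1 = b) :
    Nonempty (tor (derivedDual (constMod ℤ K.faces) n) b ≅
      homCohomology hK (n - c) (n - b) (n - a)) := by
  rcases b with b | b
  · obtain ⟨e, he⟩ := (dualResolution hK h).exists_leftDerivedIso (D := ModuleCat.{u} ℤ) b ha hc
    let T (G : CMod ℤ K.faces) := (tensor ℤ K.faces).flip.obj G
    let e₁ (G : CMod ℤ K.faces) : (tor (derivedDual (constMod ℤ K.faces) n) (Int.ofNat b)).obj G ≅
      ((dualResolution hK h).short (T G) a b c).homology := (e (T G)).symm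
    let e₂ (G : CMod ℤ K.faces) : ((dualResolution hK h).short (T G) a b c).homology ≅
      ((homShort hK (n - c) (n - b) (n - a)).obj G).homology :=
        ShortComplex.homologyMapIso (torShortIso hK h a b c G)
    refine ⟨NatIso.ofComponents (fun G => e₁ G ≪≫ e₂ G) fun {G G'} g =>
      iso_trans_naturality (e₁ G) (e₁ G') (e₂ G) (e₂ G')
        (m := ShortComplex.homologyMap ((dualResolution hK h).shortMap
          ((tensor ℤ K.faces).flip.map g) a b c)) ?_ ?_⟩
    · rw [← cancel_epi (e₁ G).inv, Iso.inv_hom_id_assoc, ← cancel_mono (e₁ G').inv]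
      simp only [Category.assoc, Iso.hom_inv_id, Category.comp_id]
      exact (he (T G) (T G') ((tensor ℤ K.faces).flip.map g)).symm
    · have key := congrArg (ShortComplex.homologyFunctor (ModuleCat.{u} ℤ)).map
        (torShortIso_naturality hK h a b c g)
      rwa [Functor.map_comp, Functor.map_comp] at key
  -- A negative degree of `Tor` corresponds to chains of dimension above `n`, which vanish.
  · exact ⟨isZero_const_punit.iso (isZero_homCohomology hK
      (isZero_faceChains_of_lt hK h (by
        have := Int.negSucc_lt_zero b
        omega)))⟩

include hK h in
lemma duality_of_link :
    IsDualityFunctorOfDegree (constMod ℤ K.faces) n ∧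
    ∀ i : ℤ, Nonempty (ext (constMod ℤ K.faces) i ≅
      tor (derivedDual (constMod ℤ K.faces) n) (n - i)) := by
  refine ⟨⟨isTypeFP_constMod hK, isEilenbergMacLane_of_isZero _ _ fun i hi => ?_⟩, fun i => ?_⟩
  · exact ((ShortComplex.exact_iff_isZero_homology _).1
      (dualShort_exact hK h rfl (sub_add_cancel i 1) hi)).of_iso
        (nonempty_derivedDual_iso hK rfl (sub_add_cancel i 1)).some
  · obtain ⟨e⟩ := nonempty_ext_iso hK (a := n - (n - i - 1)) (b := n - (n - i))
      (c := n - (n - i + 1)) (by ring) (by ring)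
    obtain ⟨e'⟩ := nonempty_tor_iso hK h (a := n - i + 1) (b := n - i) (c := n - i - 1)
      rfl (by ring)
    have hi : n - (n - i) = i := by ring
    rw [hi] at e e'
    exact ⟨e ≪≫ e'.symm⟩

end ExtTor

end DualityCategory

end

theorem theorem7 {V : Type u} (K : PreAbstractSimplicialComplex V) (hK : K.faces.Finite) (n : ℤ)
    (h : ∀ x : K.faces, ∀ i : ℤ, i ≠ n - DualityCategory.dim x.1 - 1 →
      IsZero (DualityCategory.reducedCohomology (DualityCategory.link K x.1) i)) :
    DualityCategory.IsDualityCategory K.faces ∧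
    DualityCategory.IsDualityFunctorOfDegree (DualityCategory.constMod ℤ K.faces) n ∧
    ∀ i : ℤ, Nonempty (DualityCategory.ext (DualityCategory.constMod ℤ K.faces) i ≅
      DualityCategory.tor
        (DualityCategory.derivedDual (DualityCategory.constMod ℤ K.faces) n) (n - i)) := by
  classical
  -- This is the order chosen in `reducedCohomology`, so `h` speaks of `augCochainComplex` of the
  -- links.
  let _ : LinearOrder V := linearOrderOfSTO (WellOrderingRel (α := V))
  obtain ⟨h1, h2⟩ := DualityCategory.duality_of_link hK h
  exact ⟨⟨n, h1⟩, h1, h2⟩
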